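/- Let $M$ be a compact connected Kähler manifold of complex dimension $m$ with Kähler form $\omega_M$. Let $P\to M$ be a smooth principal $T^k$-bundle, let $Q_1,\dots,Q_n\in\mathbb{Z}^k$ be weights, and let $L_j=P\times_{\rho_j}\mathbb{C}$ be the hermitian line bundle associated with the character $t\mapsto\prod_a t_a^{Q_j^a}$ of $T^k$. Fix $\tau\in\mathbb{R}^k$ and $e>0$. Let $A$ be a smooth connection on $P$, with curvature $F_A$ valued in $\mathfrak{t}^k=i\mathbb{R}^k$, and let $\phi=(\phi^1,\dots,\phi^n)$ be a smooth section of $\bigoplus_j L_j$, such that $$\bar\partial_A\phi=0,\qquad F_A^{0,2}=0 .$$ Put $I_\phi=\{j:\phi^j\not\equiv0\}$, let $S_\phi\subseteq\mathbb{R}^k$ be the real span of $\{Q_j:j\in I_\phi\}$, and let $\Delta_\phi=\{\sum_{j\in I_\phi}\lambda^jQ_j:\lambda^j\ge0\}$, whose interior is taken relative to $S_\phi$. The pair $(A,\phi)$ is called *simple* if its stabilizer in the group of gauge transformations $M\to T^k$ is discrete. It is called *$\tau$-stable* if $$\int_M\Big[\langle v,-i\Lambda F_A\rangle+2e^2\,\lambda(\phi(x),v)\Big]\frac{\omega_M^m}{m!}>0\qquad\text{for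 all } v\in\mathbb{R}^k\setminus\{0\},$$ where $\Lambda$ is the contraction with $\omega_M$, $\mu(z)=-\tfrac12\big(\sum_jQ_j|z^j|^2-\tau\big)$ is the moment map $\mathbb{C}^n\to\mathbb{R}^k$, and $\lambda(z,v)=\lim_{t\to+\infty}\langle v,\mu\rangle(\eta^v_t(z))\in(-\infty,+\infty]$ with $\eta^v_t$ the gradient flow of $\langle v,\mu\rangle$ on $\mathbb{C}^n$. (These are the notions of Mundet i Riera in this setting.) Finally, let $$\sigma=\tau\,\mathrm{Vol}\,M-\frac{2\pi m}{e^2}\,\frac{c_1(P)^{\parallel}}{[\omega_M]}\,\mathrm{Vol}\,M\in\mathbb{R}^k,$$ where $c_1(P^a)^{\parallel}$ is the component of $c_1(P^a)\in H^2(M,\mathbb{R})$ along $[\omega_M]$ for the $L^2$ inner product; that is, $c_1(P^a)^\parallel/[\omega_M]=\langle\eta^a,\omega_M\rangle_{L^2}/\langle\omega_M,\omega_M\rangle_{L^2}$ for the closed form $\eta^a=\frac{i}{2\pi}F_B^a$ representing $c_1(P^a)$, where $B$ is any connection on $P$. (When $m=0$ the second term of $\sigma$ is $0$.) Then: 1.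 $(A,\phi)$ is simple if and only if the weights $\{Q_j:\phi^j\not\equiv0\}$ span $\mathbb{R}^k$. 2. If $(A,\phi)$ is simple, then it is $\tau$-stable if and only if $\sigma$ lies in the interior of the cone $\Delta_\phi$ (for the vector $\sigma$ computed with any connection $B$ on $P$). -/

import Mathlib

open scoped Manifold ContDiff

noncomputable section

namespace GLSM

open MeasureTheory Filter Topology

/-- The model space `ℂ^m` of an `m`-dimensional complex manifold. -/
abbrev Model (m : ℕ) : Type := EuclideanSpace ℂ (Fin m)

/-- The Euclidean space `ℝ^k`, identified with the Lie algebra of `T^k` through `v ↦ i v`. -/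
abbrev RVec (k : ℕ) : Type := EuclideanSpace ℝ (Fin k)

/-! ### Differential forms in charts -/

section Forms

variable {m p : ℕ} {M V : Type*} [TopologicalSpace M] [NormedAddCommGroup V] [NormedSpace ℝ V]

/-- Coordinate expressions of a `V`-valued `p`-form: to every chart `c` of `M` a `p`-form on the
model space, of which only the values on (a part of) `c.target` matter. -/
abbrev LocalForm (m : ℕ) (M : Type*) [TopologicalSpace M] (p : ℕ) (V : Type*)
    [NormedAddCommGroup V] [NormedSpace ℝ V] : Type _ :=
  OpenPartialHomeomorph M (Model m) → Model m → Model m [⋀^Fin p]→L[ℝ] V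

/-- The family `α` of coordinate expressions is a smooth `p`-form on the open set `U ⊆ M`: each
expression is smooth, and on overlaps of charts they are related by pullback along the
coordinate change. -/
structure IsSmoothFormOn [ChartedSpace (Model m) M] (U : Set M) (α : LocalForm m M p V) :
    Prop where
  smooth : ∀ c ∈ atlas (Model m) M, ContDiffOn ℝ ∞ (α c) (c.target ∩ c.symm ⁻¹' U)
  compat : ∀ c ∈ atlas (Model m) M, ∀ c' ∈ atlas (Model m) M,
    ∀ y ∈ (c.symm.trans c').source, c.symm y ∈ U →
      α c y = (α c' (c' (c.symm y))).compContinuousLinearMap (fderiv ℝ (c' ∘ c.symm) y)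

end Forms

/-! ### Kähler manifolds -/

/-- A Kähler form on the complex manifold `M`: a smooth real 2-form that is closed, of type
`(1,1)` and positive. The Kähler metric is `g(v, w) = Ω(v, J w)`. -/
structure KahlerForm (m : ℕ) (M : Type*) [TopologicalSpace M] [ChartedSpace (Model m) M] where
  form : LocalForm m M 2 ℝ
  smooth : IsSmoothFormOn Set.univ form
  closed : ∀ c ∈ atlas (Model m) M, ∀ y ∈ c.target, extDeriv (form c) y = 0
  type_one_one : ∀ c ∈ atlas (Model m) M, ∀ y ∈ c.target, ∀ v w : Model m,
    form c y ![Complex.I • v, Complex.I • w] = form c y ![v, w]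
  positive : ∀ c ∈ atlas (Model m) M, ∀ y ∈ c.target, ∀ v : Model m, v ≠ 0 →
    0 < form c y ![v, Complex.I • v]

/-- The real basis `e_j, i e_j` of `ℂ^m`. -/
def realBasis {m : ℕ} (b : Fin m × Fin 2) : Model m :=
  (if b.2 = 0 then (1 : ℂ) else Complex.I) • EuclideanSpace.single b.1 (1 : ℂ)

/-- The Gram matrix, in the basis `realBasis`, of the metric `g(v, w) = ξ(v, i w)` of a
(positive, type `(1,1)`) form `ξ` on `ℂ^m`. -/
def gram {m : ℕ} (ξ : Model m [⋀^Fin 2]→L[ℝ] ℝ) : Matrix (Fin m × Fin 2) (Fin m × Fin 2) ℝ :=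
  Matrix.of fun a b => ξ ![realBasis a, Complex.I • realBasis b]

/-- The inner product of 2-forms induced by the metric of `ξ`, normalized so that the forms
`e^i ∧ e^j`, `i < j`, are orthonormal when the `e^i` are. -/
def formInner {m : ℕ} (ξ α β : Model m [⋀^Fin 2]→L[ℝ] ℝ) : ℝ :=
  (1 / 2) * ∑ a, ∑ b, ∑ c, ∑ d, (gram ξ)⁻¹ a c * (gram ξ)⁻¹ b d *
    α ![realBasis a, realBasis b] * β ![realBasis c, realBasis d]

/-- The contraction `Λ` with the form `ξ`, i.e. the adjoint of `f ↦ f ξ`. -/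
def contraction {m : ℕ} (ξ α : Model m [⋀^Fin 2]→L[ℝ] ℝ) : ℝ := formInner ξ α ξ

namespace KahlerForm

variable {m : ℕ} {M : Type*} [TopologicalSpace M] [ChartedSpace (Model m) M]
  [MeasurableSpace M]

/-- The measure of the volume form `Ω^m / m!`, i.e. the Riemannian volume `√(det g) dx` of the
Kähler metric. The measures on the chart domains agree on overlaps; their supremum is the measure
obtained by glueing them. -/
def vol (Ω : KahlerForm m M) : Measure M :=
  ⨆ c ∈ atlas (Model m) M,
    (((volume : Measure (Model m)).withDensity
      fun y => ENNReal.ofReal (Real.sqrt (gram (Ω.form c y)).det)).restrict c.target).map c.symm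

/-- The number `Vol M`. -/
def totalVol (Ω : KahlerForm m M) : ℝ := Ω.vol.real Set.univ

end KahlerForm

/-! ### Torus bundles, connections and sections -/

/-- A smooth principal `T^k`-bundle `P → M`, given by local trivializations over the open sets
`U i` and transition functions `g i j : U i ∩ U j → T^k`. -/
structure TorusBundle (ι : Type*) (m k : ℕ) (M : Type*) [TopologicalSpace M]
    [ChartedSpace (Model m) M] where
  U : ι → Set M
  isOpen_U : ∀ i, IsOpen (U i)
  indexAt : M → ι
  mem_indexAt : ∀ x, x ∈ U (indexAt x)
  g : ι → ι → M → Fin k → Circle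
  smooth : ∀ i j a,
    ContMDiffOn 𝓘(ℝ, Model m) 𝓘(ℝ, ℂ) ∞ (fun x => (g i j x a : ℂ)) (U i ∩ U j)
  cocycle : ∀ i j l, ∀ x ∈ U i ∩ U j ∩ U l, g i j x * g j l x = g i l x

/-- The character `t ↦ ∏ t_a ^ {q^a}` of `T^k` of weight `q`. -/
def character {k : ℕ} (q : Fin k → ℤ) (t : Fin k → Circle) : ℂ := ∏ a, (t a : ℂ) ^ q a

section Bundle

variable {ι : Type*} {m k n : ℕ} {M : Type*} [TopologicalSpace M] [ChartedSpace (Model m) M]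

/-- A connection on `P`: in each local trivialization a smooth 1-form with components in
`i ℝ = Lie U(1)`, with the usual transformation rule `A_i = A_j - g_{ij}⁻¹ d g_{ij}`. -/
structure Connection (P : TorusBundle ι m k M) where
  A : ι → Fin k → LocalForm m M 1 ℂ
  smooth : ∀ i a, IsSmoothFormOn (P.U i) (A i a)
  imaginary : ∀ i a, ∀ c ∈ atlas (Model m) M, ∀ y ∈ c.target, c.symm y ∈ P.U i →
    ∀ v : Model m, (A i a c y ![v]).re = 0
  transition : ∀ i j a, ∀ c ∈ atlas (Model m) M, ∀ y ∈ c.target,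
    c.symm y ∈ P.U i ∩ P.U j → ∀ v : Model m,
      A i a c y ![v] = A j a c y ![v] -
        (P.g i j (c.symm y) a : ℂ)⁻¹ * fderiv ℝ (fun z => (P.g i j (c.symm z) a : ℂ)) y v

/-- A smooth section `φ = (φ^1, …, φ^n)` of `⊕_j L_j`, where `L_j` is the line bundle associated
to `P` and the character of weight `Q j`. -/
structure BundleSection (P : TorusBundle ι m k M) (Q : Fin n → Fin k → ℤ) where
  φ : ι → Fin n → M → ℂ
  smooth : ∀ i j, ContMDiffOn 𝓘(ℝ, Model m) 𝓘(ℝ, ℂ) ∞ (φ i j) (P.U i)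
  transition : ∀ i l j, ∀ x ∈ P.U i ∩ P.U l, φ i j x = character (Q j) (P.g i l x) * φ l j x

variable {P : TorusBundle ι m k M} {Q : Fin n → Fin k → ℤ}

/-- The curvature `F_A = dA` (the group is abelian), in the trivialization `i` and chart `c`. -/
def Connection.curvature (A : Connection P) (i : ι) (a : Fin k) : LocalForm m M 2 ℂ :=
  fun c y => extDeriv (A.A i a c) y

/-- The real 2-form `i F_A`. -/
def Connection.iF (A : Connection P) (i : ι) (a : Fin k) : LocalForm m M 2 ℝ :=
  fun c y => Complex.reCLM.compContinuousAlternatingMap (Complex.I • A.curvature i a c y)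

/-- The covariant derivative `d_A φ^j = dφ^j + ∑_a Q_j^a A^a φ^j`, in the trivialization `i` and
chart `c`, at the point of coordinates `y`, in the direction `v`. -/
def covDeriv (A : Connection P) (s : BundleSection P Q) (i : ι) (j : Fin n)
    (c : OpenPartialHomeomorph M (Model m)) (y v : Model m) : ℂ :=
  fderiv ℝ (fun z => s.φ i j (c.symm z)) y v +
    (∑ a, (Q j a : ℂ) * A.A i a c y ![v]) * s.φ i j (c.symm y)

/-- The first vortex equation `∂̄_A φ = 0`: the `(0,1)`-part of `d_A φ` vanishes. -/
def FirstVortexEq (A : Connection P) (s : BundleSection P Q) : Prop :=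
  ∀ i j, ∀ c ∈ atlas (Model m) M, ∀ y ∈ c.target, c.symm y ∈ P.U i → ∀ v : Model m,
    (1 / 2) * (covDeriv A s i j c y v + Complex.I * covDeriv A s i j c y (Complex.I • v)) = 0

/-- The `(0,2)`-part of a complex-valued 2-form. -/
def part02 (η : Model m [⋀^Fin 2]→L[ℝ] ℂ) (v w : Model m) : ℂ :=
  (1 / 4) * (η ![v, w] + Complex.I * η ![Complex.I • v, w] + Complex.I * η ![v, Complex.I • w]
    - η ![Complex.I • v, Complex.I • w])

/-- The third vortex equation `F_A^{0,2} = 0`. -/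
def ThirdVortexEq (A : Connection P) : Prop :=
  ∀ i a, ∀ c ∈ atlas (Model m) M, ∀ y ∈ c.target, c.symm y ∈ P.U i → ∀ v w : Model m,
    part02 (A.curvature i a c y) v w = 0

/-! ### Gauge transformations and simple pairs -/

/-- The stabilizer of the pair `(A, φ)` in the group of gauge transformations `u : M → T^k`, which
act by `A ↦ A - u⁻¹ du` and `φ^j ↦ χ_{Q_j}(u) φ^j`. -/
def stabilizer (A : Connection P) (s : BundleSection P Q) : Set C(M, Fin k → Circle) :=
  {u | (∀ a, ContMDiff 𝓘(ℝ, Model m) 𝓘(ℝ, ℂ) ∞ fun x => (u x a : ℂ)) ∧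
    (∀ i a, ∀ c ∈ atlas (Model m) M, ∀ y ∈ c.target, c.symm y ∈ P.U i → ∀ v : Model m,
      A.A i a c y ![v] - (u (c.symm y) a : ℂ)⁻¹ * fderiv ℝ (fun z => (u (c.symm z) a : ℂ)) y v
        = A.A i a c y ![v]) ∧
    (∀ i j, ∀ x ∈ P.U i, character (Q j) (u x) * s.φ i j x = s.φ i j x)}

/-- The pair `(A, φ)` is simple: its stabilizer under gauge transformations is discrete. (All
derivatives of elements of the stabilizer vanish, so that the topology of uniform convergence and
the `C^∞` topology agree on it.) -/
def IsSimple (A : Connection P) (s : BundleSection P Q) : Prop :=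
  DiscreteTopology (stabilizer A s)

/-! ### Weights and cones -/

/-- The weight `Q_j` as a vector of `ℝ^k`. -/
def weight (Q : Fin n → Fin k → ℤ) (j : Fin n) : RVec k :=
  WithLp.toLp 2 fun a => (Q j a : ℝ)

namespace BundleSection

/-- `I_φ = {j : φ^j ≢ 0}`. -/
def support (s : BundleSection P Q) : Set (Fin n) := {j | ∃ i, ∃ x ∈ P.U i, s.φ i j x ≠ 0}

/-- The span `S_φ` of the weights `Q_j`, `j ∈ I_φ`. -/
def weightSpan (s : BundleSection P Q) : Submodule ℝ (RVec k) :=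
  Submodule.span ℝ (weight Q '' s.support)

/-- The closed cone `Δ_φ` generated by the weights `Q_j`, `j ∈ I_φ`. -/
def cone (s : BundleSection P Q) : Set (RVec k) :=
  {v | ∃ c : Fin n → ℝ, (∀ j, 0 ≤ c j) ∧ (∀ j ∉ s.support, c j = 0) ∧
    v = ∑ j, c j • weight Q j}

/-- The interior of the cone `Δ_φ` regarded as a subset of `S_φ`. -/
def coneInterior (s : BundleSection P Q) : Set (RVec k) :=
  Subtype.val '' interior (Subtype.val ⁻¹' s.cone : Set s.weightSpan)

/-- The value `φ(x) ∈ ℂ^n` in the trivialization chosen at `x`. -/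
def value (s : BundleSection P Q) (x : M) : EuclideanSpace ℂ (Fin n) :=
  WithLp.toLp 2 fun j => s.φ (P.indexAt x) j x

end BundleSection

/-! ### The moment map and `τ`-stability -/

/-- The moment map `μ(z) = -(1/2) (∑_j Q_j |z^j|² - τ)`. -/
def momentMap (Q : Fin n → Fin k → ℤ) (τ : RVec k) (z : EuclideanSpace ℂ (Fin n)) : RVec k :=
  (-(1 / 2) : ℝ) • ((∑ j, (‖z j‖ ^ 2) • weight Q j) - τ)

/-- The function `⟨v, μ⟩ : ℂ^n → ℝ`. -/
def momentComponent (Q : Fin n → Fin k → ℤ) (τ v : RVec k) (z : EuclideanSpace ℂ (Fin n)) : ℝ :=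
  inner ℝ v (momentMap Q τ z)

/-- `γ` is the (complete) gradient flow line of `f` starting at `z`. -/
def IsGradientFlowLine (f : EuclideanSpace ℂ (Fin n) → ℝ) (z : EuclideanSpace ℂ (Fin n))
    (γ : ℝ → EuclideanSpace ℂ (Fin n)) : Prop :=
  γ 0 = z ∧ ∀ t, HasDerivAt γ (gradient f (γ t)) t

open Classical in
/-- The gradient flow `η_t(z)` of `f` (the constant curve if there is no complete flow line). -/
def gradientFlow (f : EuclideanSpace ℂ (Fin n) → ℝ) (t : ℝ) (z : EuclideanSpace ℂ (Fin n)) :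
    EuclideanSpace ℂ (Fin n) :=
  if h : ∃ γ, IsGradientFlowLine f z γ then h.choose t else z

/-- `λ(z, v) = lim_{t → ∞} ⟨v, μ⟩(η_t^v(z))`, an extended real number, where `η^v` is the gradient
flow of `⟨v, μ⟩`. -/
def maxWeight (Q : Fin n → Fin k → ℤ) (τ : RVec k) (z : EuclideanSpace ℂ (Fin n)) (v : RVec k) :
    EReal :=
  limUnder atTop fun t : ℝ =>
    ((momentComponent Q τ v (gradientFlow (momentComponent Q τ v) t z) : ℝ) : EReal)

/-- The integral of a function with values in the extended reals. -/
def eIntegral {X : Type*} [MeasurableSpace X] (μ : Measure X) (f : X → EReal) : EReal :=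
  ((∫⁻ x, (f x).toENNReal ∂μ : ENNReal) : EReal) -
    ((∫⁻ x, (-(f x)).toENNReal ∂μ : ENNReal) : EReal)

/-- The function `i Λ F_A : M → ℝ^k`. -/
def iLambdaF (Ω : KahlerForm m M) (A : Connection P) (x : M) : RVec k :=
  WithLp.toLp 2 fun a =>
    contraction (Ω.form (chartAt (Model m) x) (chartAt (Model m) x x))
      (A.iF (P.indexAt x) a (chartAt (Model m) x) (chartAt (Model m) x x))

variable [MeasurableSpace M]

/-- The pair `(A, φ)` is `τ`-stable:
`∫_M ⟨v, -i Λ F_A⟩ + 2 e² λ(φ(x), v) > 0` for all non-zero `v ∈ ℝ^k`. -/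
def IsTauStable (Ω : KahlerForm m M) (e : ℝ) (τ : RVec k) (A : Connection P)
    (s : BundleSection P Q) : Prop :=
  ∀ v : RVec k, v ≠ 0 →
    0 < eIntegral Ω.vol fun x =>
      ((inner ℝ v (-iLambdaF Ω A x) : ℝ) : EReal) +
        ((2 * e ^ 2 : ℝ) : EReal) * maxWeight Q τ (s.value x) v

/-! ### The stability vector -/

/-- The closed 2-form `(i / 2π) F_B^a`, which represents `c_1(P^a)` by Chern-Weil theory. -/
def chernForm (B : Connection P) (i : ι) (a : Fin k) : LocalForm m M 2 ℝ :=
  fun c y => (1 / (2 * Real.pi)) • B.iF i a c y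

/-- The number `c_1(P^a)^∥ / [Ω]`: the coefficient, along `Ω`, of the `L²`-orthogonal projection
to `ℝ Ω` of a closed form that represents `c_1(P^a)`. (`Ω` is harmonic, hence `L²`-orthogonal to
the exact forms.) -/
def chernParallel (Ω : KahlerForm m M) (B : Connection P) (a : Fin k) : ℝ :=
  (∫ x, formInner (Ω.form (chartAt (Model m) x) (chartAt (Model m) x x))
      (chernForm B (P.indexAt x) a (chartAt (Model m) x) (chartAt (Model m) x x))
      (Ω.form (chartAt (Model m) x) (chartAt (Model m) x x)) ∂Ω.vol) /
  (∫ x, formInner (Ω.form (chartAt (Model m) x) (chartAt (Model m) x x))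
      (Ω.form (chartAt (Model m) x) (chartAt (Model m) x x))
      (Ω.form (chartAt (Model m) x) (chartAt (Model m) x x)) ∂Ω.vol)

/-- The vector `σ = τ Vol M - (2 π m / e²) (c_1(P)^∥ / [Ω]) Vol M`, where `c_1(P)` is represented
by the Chern form of the connection `B` on `P`. -/
def stabilityVector (Ω : KahlerForm m M) (e : ℝ) (τ : RVec k) (B : Connection P) : RVec k :=
  WithLp.toLp 2 fun a =>
    τ a * Ω.totalVol - (2 * Real.pi * m / e ^ 2) * chernParallel Ω B a * Ω.totalVol

end Bundle

end GLSM

end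

/-! Simplicity. An element `u` of the stabilizer satisfies `u⁻¹ du = 0`, so on the connected
manifold `M` it is a constant `t ∈ T^k`. It fixes `φ` exactly when the character of weight `Q_j` is
trivial on `t` for every `j ∈ I_φ`. The stabilizer is thus a closed subgroup of `T^k` with Lie
algebra the orthogonal complement of `S_φ`, and it is discrete if and only if `S_φ = ℝ^k`
(`weightSpan_eq_top_of_isSimple`, `isSimple_of_weightSpan_eq_top`).

Stability. The gradient flow of `⟨v, μ⟩` is diagonal: it multiplies `z^j` by `exp(-⟨v, Q_j⟩ t)`.
Hence `λ(z, v) = ⟨v, τ⟩ / 2` if `⟨v, Q_j⟩ ≥ 0` whenever `z^j ≠ 0`, and `λ(z, v) = +∞` otherwise. If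
`⟨v, Q_j⟩ < 0` for some `j ∈ I_φ`, the integrand is `+∞` on the nonempty open set where `φ^j ≠ 0`,
and the inequality for `v` holds automatically. Otherwise the integral is `e² ⟨v, σ⟩`, because `|ω|²
= m` turns the Chern class term of `σ` into `e⁻² ∫ iΛF` (`stabilityVector_apply`). So `τ`-stability
says that `σ` pairs positively with every nonzero `v` of the dual cone of `Δ_φ` (`isTauStable_iff`).
By Hahn-Banach this means that `σ` is interior to `Δ_φ`, once the weights span
(`mem_interior_cone_iff`).

Independence of `B`. Two connections differ by a global 1-form, and their curvatures by its
differential, so it suffices that `∫ Λ dβ = 0` (`integral_contract_extDeriv`). In a chart,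
closedness of `ω` makes `Λ dβ`, times the volume density, minus the divergence of the vector density
dual to `β` (`sum_fderiv_dualField`); a partition of unity reduces to `β` supported in one chart.
This also requires that the contraction and the volume measure be independent of charts. -/

noncomputable section

namespace GLSM

open MeasureTheory Filter Topology

/-! ### Linear algebra of two-forms on `ℂ^m` -/

section TwoForms

variable {m : ℕ}

/-- `realBasis` as a basis. -/
def stdBasis (m : ℕ) : Module.Basis (Fin m × Fin 2) ℝ (Model m) :=
  Complex.basisOneI.smulTower' (EuclideanSpace.basisFun (Fin m) ℂ).toBasis

@[simp] lemma stdBasis_apply (b : Fin m × Fin 2) : stdBasis m b = realBasis b := by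
  obtain ⟨i, j⟩ := b
  fin_cases j <;> simp [stdBasis, realBasis, Module.Basis.smulTower'_apply]

/-- Multiplication by `i` as a real linear map. -/
def mulI (m : ℕ) : Model m →ₗ[ℝ] Model m :=
  (LinearMap.lsmul ℂ (Model m) Complex.I).restrictScalars ℝ

@[simp] lemma mulI_apply (v : Model m) : mulI m v = Complex.I • v := rfl

/-- The matrix of the complex structure. -/
def matI (m : ℕ) : Matrix (Fin m × Fin 2) (Fin m × Fin 2) ℝ :=
  LinearMap.toMatrix (stdBasis m) (stdBasis m) (mulI m)

lemma matI_mul_matI : matI m * matI m = -1 := by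
  rw [matI, ← LinearMap.toMatrix_comp, ← LinearMap.toMatrix_one (stdBasis m), ← map_neg]
  congr 1
  ext1 v
  simp [smul_smul]

variable {V : Type*} [NormedAddCommGroup V] [NormedSpace ℝ V]

lemma update_pair_zero {X : Type*} (v w z : X) : Function.update ![v, w] 0 z = ![z, w] := by
  ext i
  fin_cases i <;> rfl

lemma update_pair_one {X : Type*} (v w z : X) : Function.update ![v, w] 1 z = ![v, z] := by
  ext i
  fin_cases i <;> rfl

/-- A 2-form as a bilinear map. -/
def toBilin (ξ : Model m [⋀^Fin 2]→L[ℝ] V) : Model m →ₗ[ℝ] Model m →ₗ[ℝ] V :=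
  LinearMap.mk₂ ℝ (fun v w => ξ ![v, w])
    (fun v v' w => by
      have := ξ.map_update_add ![v, w] 0 v v'
      simpa only [update_pair_zero] using this)
    (fun r v w => by
      have := ξ.map_update_smul ![v, w] 0 r v
      simpa only [update_pair_zero] using this)
    (fun v w w' => by
      have := ξ.map_update_add ![v, w] 1 w w'
      simpa only [update_pair_one] using this)
    (fun r v w => by
      have := ξ.map_update_smul ![v, w] 1 r w
      simpa only [update_pair_one] using this)

@[simp] lemma toBilin_apply (ξ : Model m [⋀^Fin 2]→L[ℝ] V) (v w : Model m) :
    toBilin ξ v w = ξ ![v, w] := rfl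

lemma twoForm_swap (ξ : Model m [⋀^Fin 2]→L[ℝ] V) (v w : Model m) :
    ξ ![v, w] = -ξ ![w, v] := by
  have := ξ.map_swap ![w, v] (i := 0) (j := 1) (by simp)
  have e : ![w, v] ∘ Equiv.swap (0 : Fin 2) 1 = ![v, w] := by
    ext i
    fin_cases i <;> rfl
  rw [e] at this
  exact this

/-- The matrix of a 2-form in the basis `realBasis`. -/
def formMatrix (ξ : Model m [⋀^Fin 2]→L[ℝ] ℝ) : Matrix (Fin m × Fin 2) (Fin m × Fin 2) ℝ :=
  LinearMap.toMatrix₂ (stdBasis m) (stdBasis m) (toBilin ξ)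

lemma formMatrix_apply (ξ : Model m [⋀^Fin 2]→L[ℝ] ℝ) (a b) :
    formMatrix ξ a b = ξ ![realBasis a, realBasis b] := by
  simp [formMatrix, LinearMap.toMatrix₂_apply]

lemma formMatrix_swap (ξ : Model m [⋀^Fin 2]→L[ℝ] ℝ) (a b) :
    formMatrix ξ a b = -formMatrix ξ b a := by
  rw [formMatrix_apply, formMatrix_apply, twoForm_swap]

/-- Splitting off the constant complex structure leaves a factor that transforms by congruence under
every real linear map. The transformation rules below therefore need no complex linearity of the
coordinate change. -/
lemma gram_eq (ξ : Model m [⋀^Fin 2]→L[ℝ] ℝ) : gram ξ = formMatrix ξ * matI m := by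
  rw [formMatrix, matI, ← LinearMap.toMatrix₂_compl₂]
  ext a b
  simp [gram, LinearMap.toMatrix₂_apply]

lemma formMatrix_comp (ξ : Model m [⋀^Fin 2]→L[ℝ] ℝ) (D : Model m →L[ℝ] Model m) :
    formMatrix (ξ.compContinuousLinearMap D) =
      (LinearMap.toMatrix (stdBasis m) (stdBasis m) D.toLinearMap).transpose * formMatrix ξ *
        LinearMap.toMatrix (stdBasis m) (stdBasis m) D.toLinearMap := by
  rw [formMatrix, formMatrix, ← LinearMap.toMatrix₂_compl₁₂]
  congr 1
  ext v w
  simp only [toBilin_apply, LinearMap.compl₁₂_apply,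
    ContinuousAlternatingMap.compContinuousLinearMap_apply]
  congr 1
  ext i
  fin_cases i <;> rfl

/-- A positive form of type `(1,1)`. -/
structure IsPositiveForm (ξ : Model m [⋀^Fin 2]→L[ℝ] ℝ) : Prop where
  type_one_one : ∀ v w : Model m, ξ ![Complex.I • v, Complex.I • w] = ξ ![v, w]
  positive : ∀ v : Model m, v ≠ 0 → 0 < ξ ![v, Complex.I • v]

namespace IsPositiveForm

variable {ξ : Model m [⋀^Fin 2]→L[ℝ] ℝ}

lemma symm (h : IsPositiveForm ξ) (v w : Model m) :
    ξ ![v, Complex.I • w] = ξ ![w, Complex.I • v] := by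
  rw [← h.type_one_one v, smul_smul, Complex.I_mul_I, neg_smul, one_smul, twoForm_swap ξ w]
  exact (toBilin ξ (Complex.I • v)).map_neg w

lemma gram_transpose (h : IsPositiveForm ξ) : (gram ξ).transpose = gram ξ := by
  ext a b
  exact h.symm _ _

lemma posDef_gram (h : IsPositiveForm ξ) : (gram ξ).PosDef := by
  refine Matrix.PosDef.of_dotProduct_mulVec_pos ?_ ?_
  · ext a b
    simpa [gram] using h.symm _ _
  · intro x hx
    set v := (stdBasis m).equivFun.symm x with hv
    have hx' : x = (stdBasis m).equivFun v := by
      rw [hv, LinearEquiv.apply_symm_apply]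
    have hv0 : v ≠ 0 := by
      rintro h0
      exact hx (by rw [hx', h0, map_zero])
    have key := h.positive v hv0
    have e : gram ξ = LinearMap.toMatrix₂ (stdBasis m) (stdBasis m)
        ((toBilin ξ).compl₂ (mulI m)) := by
      ext a b
      simp [gram, LinearMap.toMatrix₂_apply]
    have := dotProduct_toMatrix₂_mulVec (stdBasis m) (stdBasis m)
      ((toBilin ξ).compl₂ (mulI m)) x x
    rw [← e, ← hv] at this
    simp only [LinearMap.compl₂_apply, toBilin_apply, mulI_apply] at this
    rw [← this] at key
    simpa using key

lemma det_gram_pos (h : IsPositiveForm ξ) : 0 < (gram ξ).det := h.posDef_gram.det_pos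

lemma isUnit_det (h : IsPositiveForm ξ) : IsUnit (formMatrix ξ).det := by
  have := h.det_gram_pos
  rw [gram_eq, Matrix.det_mul] at this
  exact isUnit_iff_ne_zero.2 (left_ne_zero_of_mul this.ne')

lemma inv_gram (h : IsPositiveForm ξ) : (gram ξ)⁻¹ = -(matI m * (formMatrix ξ)⁻¹) := by
  apply Matrix.inv_eq_right_inv
  rw [gram_eq, mul_neg, Matrix.mul_assoc, ← Matrix.mul_assoc (matI m), matI_mul_matI]
  simp [Matrix.mul_nonsing_inv _ h.isUnit_det]

/-- The contraction with a positive form, in terms of matrices. -/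
lemma contraction_eq_sum (h : IsPositiveForm ξ) (α : Model m [⋀^Fin 2]→L[ℝ] ℝ) :
    contraction ξ α = -(1 / 2) * ∑ a, ∑ b, (formMatrix ξ)⁻¹ a b * formMatrix α a b := by
  have hG : ((gram ξ)⁻¹).transpose = (gram ξ)⁻¹ := by
    rw [Matrix.transpose_nonsing_inv, h.gram_transpose]
  -- Write `W` for the form matrix and `J` for `matI`. Raising both indices of `ξ` gives `(-J W⁻¹) W
  -- (-J W⁻¹) = J² W⁻¹ = -W⁻¹`.
  have key : (gram ξ)⁻¹ * formMatrix ξ * (gram ξ)⁻¹ = -(formMatrix ξ)⁻¹ := by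
    conv_lhs => rw [h.inv_gram]
    rw [Matrix.neg_mul, Matrix.mul_assoc (matI m), Matrix.nonsing_inv_mul _ h.isUnit_det,
      Matrix.mul_one, neg_mul_neg, ← Matrix.mul_assoc, matI_mul_matI, neg_one_mul]
  have entry : ∀ a b, (formMatrix ξ)⁻¹ a b =
      -∑ c, ∑ d, (gram ξ)⁻¹ a c * (gram ξ)⁻¹ b d * formMatrix ξ c d := by
    intro a b
    have := congrFun (congrFun key a) b
    rw [Matrix.neg_apply] at this
    rw [eq_neg_iff_add_eq_zero, ← neg_eq_iff_add_eq_zero, ← this, Matrix.mul_apply]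
    rw [Finset.sum_comm]
    refine Finset.sum_congr rfl fun d _ => ?_
    rw [Matrix.mul_apply, Finset.sum_mul]
    refine Finset.sum_congr rfl fun c _ => ?_
    rw [← congrFun (congrFun hG b) d, Matrix.transpose_apply]
    ring
  simp only [contraction, formInner, entry, ← formMatrix_apply]
  rw [neg_mul, ← mul_neg, ← Finset.sum_neg_distrib]
  congr 1
  refine Finset.sum_congr rfl fun a _ => ?_
  rw [← Finset.sum_neg_distrib]
  refine Finset.sum_congr rfl fun b _ => ?_
  rw [neg_mul, neg_neg, Finset.sum_mul]
  refine Finset.sum_congr rfl fun c _ => ?_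
  rw [Finset.sum_mul]
  refine Finset.sum_congr rfl fun d _ => ?_
  ring

/-- Antisymmetry of `α` absorbs the sign. The trace form makes the invariance under changes of basis
visible. -/
lemma contraction_eq_trace (h : IsPositiveForm ξ) (α : Model m [⋀^Fin 2]→L[ℝ] ℝ) :
    contraction ξ α = (1 / 2) * ((formMatrix ξ)⁻¹ * formMatrix α).trace := by
  rw [h.contraction_eq_sum, Matrix.trace, neg_mul, ← mul_neg, ← Finset.sum_neg_distrib]
  congr 1
  refine Finset.sum_congr rfl fun a _ => ?_
  rw [Matrix.diag_apply, Matrix.mul_apply, ← Finset.sum_neg_distrib]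
  refine Finset.sum_congr rfl fun b _ => ?_
  rw [formMatrix_swap α a b]
  ring

/-- Half the trace of the identity matrix of size `2m`. This is what cancels the factor `m` in `σ`.
-/
lemma contraction_self (h : IsPositiveForm ξ) : contraction ξ ξ = m := by
  rw [h.contraction_eq_trace, Matrix.nonsing_inv_mul _ h.isUnit_det, Matrix.trace_one]
  simp only [Fintype.card_prod, Fintype.card_fin, Nat.cast_mul]
  ring

/-- Under pullback by `T`, the matrix whose trace is taken is conjugated by `T`. Nondegeneracy of
`ξ'` forces `T` to be invertible. -/
lemma contraction_comp (h : IsPositiveForm ξ) {ξ' : Model m [⋀^Fin 2]→L[ℝ] ℝ}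
    (h' : IsPositiveForm ξ') {D : Model m →L[ℝ] Model m} (hD : ξ' = ξ.compContinuousLinearMap D)
    (α : Model m [⋀^Fin 2]→L[ℝ] ℝ) :
    contraction ξ' (α.compContinuousLinearMap D) = contraction ξ α := by
  rw [h.contraction_eq_trace, h'.contraction_eq_trace]
  have h1 := h'.isUnit_det
  rw [hD] at h1 ⊢
  rw [formMatrix_comp] at h1 ⊢
  rw [formMatrix_comp]
  set T := LinearMap.toMatrix (stdBasis m) (stdBasis m) D.toLinearMap
  have hT : IsUnit T.det := by
    rw [Matrix.det_mul] at h1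
    exact isUnit_of_mul_isUnit_right h1
  have hT' : IsUnit T.transpose.det := by rwa [Matrix.det_transpose]
  congr 1
  rw [Matrix.mul_inv_rev, Matrix.mul_inv_rev]
  have : T⁻¹ * ((formMatrix ξ)⁻¹ * T.transpose⁻¹) * (T.transpose * formMatrix α * T) =
      T⁻¹ * ((formMatrix ξ)⁻¹ * ((T.transpose⁻¹ * T.transpose) * formMatrix α) * T) := by
    simp only [Matrix.mul_assoc]
  rw [this, Matrix.nonsing_inv_mul _ hT', Matrix.one_mul, Matrix.trace_mul_comm, Matrix.mul_assoc,
    Matrix.mul_nonsing_inv _ hT, Matrix.mul_one]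

end IsPositiveForm

lemma det_gram_comp (ξ : Model m [⋀^Fin 2]→L[ℝ] ℝ) (D : Model m →L[ℝ] Model m) :
    (gram (ξ.compContinuousLinearMap D)).det = D.det ^ 2 * (gram ξ).det := by
  rw [gram_eq, gram_eq, formMatrix_comp]
  simp only [Matrix.det_mul, Matrix.det_transpose, LinearMap.det_toMatrix]
  rw [ContinuousLinearMap.det]
  ring

lemma contraction_add (ξ α β : Model m [⋀^Fin 2]→L[ℝ] ℝ) :
    contraction ξ (α + β) = contraction ξ α + contraction ξ β := by
  simp only [contraction, formInner, ContinuousAlternatingMap.add_apply, mul_add, add_mul,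
    Finset.sum_add_distrib]

lemma contraction_smul (ξ α : Model m [⋀^Fin 2]→L[ℝ] ℝ) (r : ℝ) :
    contraction ξ (r • α) = r * contraction ξ α := by
  simp only [contraction, formInner, ContinuousAlternatingMap.smul_apply, Finset.mul_sum,
    smul_eq_mul]
  refine Finset.sum_congr rfl fun a _ => Finset.sum_congr rfl fun b _ =>
    Finset.sum_congr rfl fun c _ => Finset.sum_congr rfl fun d _ => ?_
  ring

lemma contraction_sum {κ : Type*} (t : Finset κ) (ξ : Model m [⋀^Fin 2]→L[ℝ] ℝ)
    (α : κ → Model m [⋀^Fin 2]→L[ℝ] ℝ) :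
    contraction ξ (∑ i ∈ t, α i) = ∑ i ∈ t, contraction ξ (α i) := by
  classical
  induction t using Finset.induction_on with
  | empty => simp [contraction, formInner]
  | insert a t ha ih => rw [Finset.sum_insert ha, Finset.sum_insert ha, contraction_add, ih]

end TwoForms

/-! ### Calculus of matrix-valued functions -/

section MatrixCalculus

variable {E B : Type*} [NormedAddCommGroup E] [NormedSpace ℝ E] [Fintype B] [DecidableEq B]
  {N : E → Matrix B B ℝ} {U : Set E} {r : WithTop ℕ∞} {y : E}

lemma contDiffOn_det (h : ∀ a b, ContDiffOn ℝ r (fun y => N y a b) U) :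
    ContDiffOn ℝ r (fun y => (N y).det) U := by
  simp only [Matrix.det_apply]
  refine ContDiffOn.sum fun σ _ => ?_
  refine ContDiffOn.const_smul _ ?_
  exact contDiffOn_prod fun i _ => h _ _

lemma contDiffOn_inv_apply (h : ∀ a b, ContDiffOn ℝ r (fun y => N y a b) U)
    (hN : ∀ y ∈ U, IsUnit (N y).det) (a b : B) :
    ContDiffOn ℝ r (fun y => (N y)⁻¹ a b) U := by
  simp only [Matrix.inv_def, Matrix.smul_apply, Ring.inverse_eq_inv', smul_eq_mul,
    Matrix.adjugate_apply]
  refine ((contDiffOn_det h).inv fun y hy => (hN y hy).ne_zero).mul (contDiffOn_det fun c d => ?_)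
  -- An adjugate entry is a determinant in which row `b` has been replaced by a constant unit
  -- vector; the other rows are those of `N`.
  by_cases hc : c = b
  · subst hc
    simpa using contDiffOn_const
  · simpa [Matrix.updateRow_ne hc] using h c d

/-- Jacobi's formula. -/
lemma fderiv_det (h : ∀ a b, DifferentiableAt ℝ (fun y => N y a b) y)
    (hN : IsUnit (N y).det) (v : E) :
    fderiv ℝ (fun y => (N y).det) y v = (N y).det *
      ((N y)⁻¹ * Matrix.of fun a b => fderiv ℝ (fun y => N y a b) y v).trace := by
  set N' : Matrix B B ℝ := Matrix.of fun a b => fderiv ℝ (fun y => N y a b) y v with hN'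
  let F : (B → B → ℝ) → ℝ := fun A => (Matrix.of A).det
  have hF : Differentiable ℝ F := by
    simp only [F, Matrix.det_apply, Matrix.of_apply]
    fun_prop
  let G : E → B → B → ℝ := fun y => N y
  have hG : HasFDerivAt G
      (ContinuousLinearMap.pi fun a => ContinuousLinearMap.pi fun b =>
        fderiv ℝ (fun y => N y a b) y) y :=
    hasFDerivAt_pi.2 fun a => hasFDerivAt_pi.2 fun b => (h a b).hasFDerivAt
  have h1 : HasFDerivAt (fun y => (N y).det) _ y := ((hF (G y)).hasFDerivAt).comp y hG
  rw [h1.fderiv]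
  let A' : B → B → ℝ := fun a b => fderiv ℝ (fun y => N y a b) y v
  -- The derivative of the determinant is read off along the line `t ↦ N + t N'`, where `det (N + t
  -- N') = det N * det (1 + t N⁻¹ N')` is a polynomial in `t`.
  have h2 : HasDerivAt (fun t : ℝ => F (G y + t • A')) (fderiv ℝ F (G y) A') 0 := by
    have hl : HasDerivAt (fun t : ℝ => G y + t • A') A' 0 := by
      simpa using ((hasDerivAt_id (0 : ℝ)).smul_const A').const_add (G y)
    have hFy : HasFDerivAt F (fderiv ℝ F (G y)) (G y + (0 : ℝ) • A') := by
      simpa using (hF (G y)).hasFDerivAt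
    exact hFy.comp_hasDerivAt (0 : ℝ) hl
  -- The part of `det (1 + t N⁻¹ N')` of order at least two, divided by `t²`.
  set p := ((1 + (Polynomial.X : Polynomial ℝ) • ((N y)⁻¹ * N').map Polynomial.C :
    Matrix B B (Polynomial ℝ)).det).divX.divX
  have h3 : (fun t : ℝ => F (G y + t • A')) = fun t : ℝ => (N y).det *
      (1 + ((N y)⁻¹ * N').trace * t + p.eval t * t ^ 2) := by
    funext t
    rw [← Matrix.det_one_add_smul, ← Matrix.det_mul, Matrix.mul_add, Matrix.mul_one,
      Matrix.mul_smul, ← Matrix.mul_assoc, Matrix.mul_nonsing_inv _ hN, Matrix.one_mul]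
    rfl
  rw [h3] at h2
  have h4 : HasDerivAt (fun t : ℝ => (N y).det *
      (1 + ((N y)⁻¹ * N').trace * t + p.eval t * t ^ 2)) ((N y).det * ((N y)⁻¹ * N').trace) 0 := by
    have h5 := ((((hasDerivAt_id (0 : ℝ)).const_mul (((N y)⁻¹ * N').trace)).const_add 1).add
      ((p.hasDerivAt 0).mul ((hasDerivAt_id (0 : ℝ)).pow 2))).const_mul (N y).det
    simpa [Pi.add_def, Pi.mul_def] using h5
  exact h2.unique h4

/-- Differentiate `N⁻¹ N = 1`, which holds in a neighbourhood of `y`, and multiply by `N⁻¹` on the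
right. -/
lemma fderiv_inv_apply (h : ∀ a b, DifferentiableAt ℝ (fun y => N y a b) y)
    (h' : ∀ a b, DifferentiableAt ℝ (fun y => (N y)⁻¹ a b) y)
    (hN : ∀ᶠ z in 𝓝 y, IsUnit (N z).det) (v : E) (a b : B) :
    fderiv ℝ (fun y => (N y)⁻¹ a b) y v = -∑ d, ∑ e,
      (N y)⁻¹ a d * fderiv ℝ (fun y => N y d e) y v * (N y)⁻¹ e b := by
  set P' : Matrix B B ℝ := Matrix.of fun a b => fderiv ℝ (fun y => (N y)⁻¹ a b) y v with hP'
  set N' : Matrix B B ℝ := Matrix.of fun a b => fderiv ℝ (fun y => N y a b) y v with hN'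
  have key : P' * N y + (N y)⁻¹ * N' = 0 := by
    ext a b
    have h1 : (fun z => ∑ c, (N z)⁻¹ a c * N z c b) =ᶠ[𝓝 y] fun _ => (1 : Matrix B B ℝ) a b := by
      filter_upwards [hN] with z hz
      rw [← Matrix.mul_apply, Matrix.nonsing_inv_mul _ hz]
    have h2 : HasFDerivAt (fun z => ∑ c, (N z)⁻¹ a c * N z c b) _ y :=
      HasFDerivAt.fun_sum fun c _ => (h' a c).hasFDerivAt.mul (h c b).hasFDerivAt
    have h3 := h2.fderiv
    rw [h1.fderiv_eq, fderiv_fun_const] at h3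
    have h4 := congrArg (fun L => L v) h3
    simp only [Pi.zero_apply, zero_apply, sum_apply, add_apply, smul_apply, smul_eq_mul,
      Finset.sum_add_distrib] at h4
    rw [Matrix.add_apply, Matrix.mul_apply, Matrix.mul_apply, Matrix.zero_apply, h4, add_comm]
    congr 1
    exact Finset.sum_congr rfl fun c _ => mul_comm _ _
  have hP : P' = -((N y)⁻¹ * N' * (N y)⁻¹) := by
    have h1 := congrArg (· * (N y)⁻¹) (eq_neg_of_add_eq_zero_left key)
    simpa only [Matrix.mul_assoc, Matrix.mul_nonsing_inv _ hN.self_of_nhds, Matrix.mul_one,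
      Matrix.neg_mul] using h1
  have := congrFun (congrFun hP a) b
  rw [hP', Matrix.of_apply] at this
  rw [this, Matrix.neg_apply, Matrix.mul_apply, Finset.sum_comm]
  congr 1
  refine Finset.sum_congr rfl fun e _ => ?_
  rw [Matrix.mul_apply, Finset.sum_mul]
  rfl

omit [DecidableEq B] in
/-- The cancellation behind the invariance of the Liouville volume under Hamiltonian-type vector
fields: `P` is the inverse of a symplectic matrix and `dW` the derivative of that matrix. -/
lemma symplectic_divergence_identity (P : B → B → ℝ) (dW : B → B → B → ℝ)
    (hP : ∀ a b, P a b = -P b a) (hW : ∀ c a b, dW c a b = -dW c b a)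
    (cyc : ∀ a d e, dW a d e - dW d a e + dW e a d = 0) (b : B) :
    ∑ a, ((1 / 2) * (∑ d, ∑ e, P d e * dW a e d) * P a b -
      ∑ d, ∑ e, P a d * dW a d e * P e b) = 0 := by
  -- Contracting the cyclic identity with the antisymmetric `P` makes its first two terms equal.
  -- This trades the derivative in a summed direction for one in the free direction `e`.
  have h1 : ∀ e, 2 * ∑ a, ∑ d, P a d * dW a d e = -∑ a, ∑ d, P a d * dW e a d := by
    intro e
    have h2 : ∑ a, ∑ d, P a d * dW d a e = -∑ a, ∑ d, P a d * dW a d e := by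
      rw [Finset.sum_comm, ← Finset.sum_neg_distrib]
      refine Finset.sum_congr rfl fun a _ => ?_
      rw [← Finset.sum_neg_distrib]
      refine Finset.sum_congr rfl fun d _ => ?_
      rw [hP d a]; ring
    have h3 : ∑ a, ∑ d, P a d * (dW a d e - dW d a e + dW e a d) = 0 := by
      simp [cyc]
    simp only [mul_add, mul_sub, Finset.sum_add_distrib, Finset.sum_sub_distrib] at h3
    linarith
  have h4 : ∑ a, ∑ d, ∑ e, P a d * dW a d e * P e b =
      ∑ e, (∑ a, ∑ d, P a d * dW a d e) * P e b := by
    simp only [Finset.sum_mul]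
    rw [Finset.sum_comm' (t' := Finset.univ) (s' := fun _ => Finset.univ) (by simp)]
    rw [Finset.sum_comm]
    conv_rhs => rw [Finset.sum_comm]
    refine Finset.sum_congr rfl fun a _ => ?_
    rw [Finset.sum_comm]
  rw [Finset.sum_sub_distrib, h4, ← Finset.sum_sub_distrib]
  refine Finset.sum_eq_zero fun e _ => ?_
  have h5 : ∑ d, ∑ f, P d f * dW e f d = -∑ a, ∑ d, P a d * dW e a d := by
    rw [← Finset.sum_neg_distrib]
    refine Finset.sum_congr rfl fun a _ => ?_
    rw [← Finset.sum_neg_distrib]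
    refine Finset.sum_congr rfl fun d _ => ?_
    rw [hW e a d]; ring
  rw [h5, ← h1 e]
  ring

end MatrixCalculus

/-! ### Exterior derivatives in coordinates -/

section ExtDeriv

variable {E V : Type*} [NormedAddCommGroup E] [NormedSpace ℝ E] [NormedAddCommGroup V]
  [NormedSpace ℝ V]

lemma contDiffOn_form_apply {p : ℕ} {r : WithTop ℕ∞} {α : E → E [⋀^Fin p]→L[ℝ] V} {U : Set E}
    (h : ContDiffOn ℝ r α U) (v : Fin p → E) : ContDiffOn ℝ r (fun y => α y v) U :=
  (ContinuousAlternatingMap.apply ℝ E V v).contDiff.comp_contDiffOn h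

lemma extDeriv_oneForm {α : E → E [⋀^Fin 1]→L[ℝ] V} {y : E} (h : DifferentiableAt ℝ α y)
    (v w : E) : extDeriv α y ![v, w] =
      fderiv ℝ (fun z => α z ![w]) y v - fderiv ℝ (fun z => α z ![v]) y w := by
  have h0 : Fin.removeNth (0 : Fin 2) ![v, w] = ![w] := by ext i; fin_cases i; rfl
  have h1 : Fin.removeNth (1 : Fin 2) ![v, w] = ![v] := by ext i; fin_cases i; rfl
  rw [extDeriv_apply h, Fin.sum_univ_two, h0, h1]
  simp [sub_eq_add_neg]

lemma extDeriv_twoForm {α : E → E [⋀^Fin 2]→L[ℝ] V} {y : E} (h : DifferentiableAt ℝ α y)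
    (u v w : E) : extDeriv α y ![u, v, w] =
      fderiv ℝ (fun z => α z ![v, w]) y u - fderiv ℝ (fun z => α z ![u, w]) y v +
        fderiv ℝ (fun z => α z ![u, v]) y w := by
  have h0 : Fin.removeNth (0 : Fin 3) ![u, v, w] = ![v, w] := by
    ext i; fin_cases i <;> rfl
  have h1 : Fin.removeNth (1 : Fin 3) ![u, v, w] = ![u, w] := by
    ext i; fin_cases i <;> rfl
  have h2 : Fin.removeNth (2 : Fin 3) ![u, v, w] = ![u, v] := by
    ext i; fin_cases i <;> rfl
  rw [extDeriv_apply h, Fin.sum_univ_three, h0, h1, h2]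
  simp [sub_eq_add_neg]

lemma contDiffOn_extDeriv {p : ℕ} {α : E → E [⋀^Fin p]→L[ℝ] V} {U : Set E} (hU : IsOpen U)
    (h : ContDiffOn ℝ ∞ α U) : ContDiffOn ℝ ∞ (extDeriv α) U :=
  (ContinuousAlternatingMap.alternatizeUncurryFinCLM ℝ E V).contDiff.comp_contDiffOn
    (h.fderiv_of_isOpen hU (by simp))

end ExtDeriv

/-! ### The divergence theorem in a chart -/

/-- The integral of a partial derivative of a compactly supported function vanishes. -/
lemma integral_fderiv_eq_zero {E : Type*} [NormedAddCommGroup E] [NormedSpace ℝ E]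
    [FiniteDimensional ℝ E] [MeasurableSpace E] [BorelSpace E] (μ : Measure E) [μ.IsAddHaarMeasure]
    {f : E → ℝ} {U K : Set E} (hU : IsOpen U) (hK : IsCompact K) (hKU : K ⊆ U)
    (hf : ContDiffOn ℝ 1 f U) (h0 : ∀ y ∈ U, y ∉ K → f y = 0) (v : E) :
    IntegrableOn (fun y => fderiv ℝ f y v) U μ ∧ ∫ y in U, fderiv ℝ f y v ∂μ = 0 := by
  -- The extension by zero is `C¹` on the whole space because `f` vanishes on `U` outside the
  -- compact set `K ⊆ U`.
  set F : E → ℝ := U.indicator f with hF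
  have hFU : ∀ y ∈ U, F =ᶠ[𝓝 y] f := fun y hy => by
    filter_upwards [hU.mem_nhds hy] with z hz
    exact Set.indicator_of_mem hz f
  have hFK : ∀ y ∉ K, F y = 0 := fun y hy => by
    by_cases hyU : y ∈ U
    · rw [hF, Set.indicator_of_mem hyU, h0 y hyU hy]
    · rw [hF, Set.indicator_of_notMem hyU]
  have hF1 : ContDiff ℝ 1 F := by
    rw [contDiff_iff_contDiffAt]
    intro y
    by_cases hy : y ∈ U
    · exact (hf.contDiffAt (hU.mem_nhds hy)).congr_of_eventuallyEq (hFU y hy)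
    · have : F =ᶠ[𝓝 y] fun _ => 0 := by
        filter_upwards [hK.isClosed.isOpen_compl.mem_nhds (fun h => hy (hKU h) : y ∈ Kᶜ)] with z hz
        exact hFK z hz
      exact contDiffAt_const.congr_of_eventuallyEq this
  have hFc : HasCompactSupport F := HasCompactSupport.intro hK hFK
  have hint : Integrable (fun y => fderiv ℝ F y v) μ := by
    refine Continuous.integrable_of_hasCompactSupport ?_ (hFc.fderiv_apply ℝ v)
    exact (hF1.continuous_fderiv one_ne_zero).clm_apply continuous_const
  have heq : ∀ y ∈ U, fderiv ℝ F y v = fderiv ℝ f y v := fun y hy => by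
    rw [(hFU y hy).fderiv_eq]
  have hsupp : ∀ y ∉ U, fderiv ℝ F y v = 0 := fun y hy => by
    have : F =ᶠ[𝓝 y] fun _ => 0 := by
      filter_upwards [hK.isClosed.isOpen_compl.mem_nhds (fun h => hy (hKU h) : y ∈ Kᶜ)] with z hz
      exact hFK z hz
    rw [this.fderiv_eq]
    simp
  refine ⟨(hint.integrableOn (s := U)).congr_fun heq hU.measurableSet, ?_⟩
  rw [← setIntegral_congr_fun hU.measurableSet heq,
    setIntegral_eq_integral_of_forall_compl_eq_zero hsupp]
  -- Integration by parts against the constant function `1`.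
  have := integral_mul_fderiv_eq_neg_fderiv_mul_of_integrable (μ := μ) (f := fun _ : E => (1 : ℝ))
    (g := F) (v := v) (by simp) (by simpa using hint)
    (by simpa using hF1.continuous.integrable_of_hasCompactSupport hFc)
    (fun _ _ => by fun_prop) (fun y _ => (hF1.differentiable one_ne_zero y))
  simpa using this

section Divergence

variable {m : ℕ}

/-- The density of the volume form of a positive form. -/
def volDensity (ξ : Model m [⋀^Fin 2]→L[ℝ] ℝ) : ℝ := Real.sqrt (gram ξ).det

variable {ξ : Model m → Model m [⋀^Fin 2]→L[ℝ] ℝ} {α : Model m → Model m [⋀^Fin 1]→L[ℝ] ℝ}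
  {U : Set (Model m)}

lemma contDiffOn_formMatrix {r : WithTop ℕ∞} (hξ : ContDiffOn ℝ r ξ U) (a b) :
    ContDiffOn ℝ r (fun y => formMatrix (ξ y) a b) U := by
  simp only [formMatrix_apply]
  exact contDiffOn_form_apply hξ _

lemma contDiffOn_formMatrix_inv {r : WithTop ℕ∞} (hξ : ContDiffOn ℝ r ξ U)
    (hpos : ∀ y ∈ U, IsPositiveForm (ξ y)) (a b) :
    ContDiffOn ℝ r (fun y => (formMatrix (ξ y))⁻¹ a b) U :=
  contDiffOn_inv_apply (contDiffOn_formMatrix hξ) (fun y hy => (hpos y hy).isUnit_det) a b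

lemma contDiffOn_gram_det {r : WithTop ℕ∞} (hξ : ContDiffOn ℝ r ξ U) :
    ContDiffOn ℝ r (fun y => (gram (ξ y)).det) U :=
  contDiffOn_det fun _ _ => contDiffOn_form_apply hξ _

lemma contDiffOn_volDensity {r : WithTop ℕ∞} (hξ : ContDiffOn ℝ r ξ U)
    (hpos : ∀ y ∈ U, IsPositiveForm (ξ y)) : ContDiffOn ℝ r (fun y => volDensity (ξ y)) U :=
  (contDiffOn_gram_det hξ).sqrt fun y hy => (hpos y hy).det_gram_pos.ne'

lemma contDiffOn_contraction {r : WithTop ℕ∞} {η : Model m → Model m [⋀^Fin 2]→L[ℝ] ℝ}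
    (hξ : ContDiffOn ℝ r ξ U) (hpos : ∀ y ∈ U, IsPositiveForm (ξ y)) (hη : ContDiffOn ℝ r η U) :
    ContDiffOn ℝ r (fun y => contraction (ξ y) (η y)) U := by
  have : ContDiffOn ℝ r (fun y => -(1 / 2) *
      ∑ a, ∑ b, (formMatrix (ξ y))⁻¹ a b * formMatrix (η y) a b) U := by
    refine contDiffOn_const.mul (ContDiffOn.sum fun a _ => ContDiffOn.sum fun b _ => ?_)
    exact (contDiffOn_formMatrix_inv hξ hpos a b).mul (contDiffOn_formMatrix hη a b)
  exact this.congr fun y hy => (hpos y hy).contraction_eq_sum _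

lemma IsPositiveForm.volDensity_pos {ξ : Model m [⋀^Fin 2]→L[ℝ] ℝ} (h : IsPositiveForm ξ) :
    0 < volDensity ξ := Real.sqrt_pos.2 h.det_gram_pos

/-- The logarithmic derivative of `√det G` is half that of `det W`, since `G = W J` with `J`
constant; then Jacobi's formula applies. -/
lemma fderiv_volDensity (hU : IsOpen U) (hξ : ContDiffOn ℝ ∞ ξ U)
    (hpos : ∀ y ∈ U, IsPositiveForm (ξ y)) {y : Model m} (hy : y ∈ U) (v : Model m) :
    fderiv ℝ (fun y => volDensity (ξ y)) y v = volDensity (ξ y) * ((1 / 2) *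
      ∑ d, ∑ e, (formMatrix (ξ y))⁻¹ d e * fderiv ℝ (fun y => formMatrix (ξ y) e d) y v) := by
  have hW : ∀ a b, DifferentiableAt ℝ (fun y => formMatrix (ξ y) a b) y := fun a b =>
    ((contDiffOn_formMatrix hξ a b).contDiffAt (hU.mem_nhds hy)).differentiableAt (by simp)
  have hdet : DifferentiableAt ℝ (fun y => (formMatrix (ξ y)).det) y :=
    ((contDiffOn_det (contDiffOn_formMatrix hξ)).contDiffAt
      (hU.mem_nhds hy)).differentiableAt (by simp)
  have hg : (fun y => (gram (ξ y)).det) = fun y => (formMatrix (ξ y)).det * (matI m).det := by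
    funext y
    rw [gram_eq, Matrix.det_mul]
  have h1 : HasFDerivAt (fun y => (gram (ξ y)).det)
      ((matI m).det • fderiv ℝ (fun y => (formMatrix (ξ y)).det) y) y := by
    rw [hg]
    exact hdet.hasFDerivAt.mul_const' _ |>.congr_fderiv (by ext; simp)
  have hp := (hpos y hy).det_gram_pos
  have h2 := (h1.sqrt hp.ne').fderiv
  change fderiv ℝ (fun y => Real.sqrt (gram (ξ y)).det) y v = Real.sqrt (gram (ξ y)).det * _
  rw [h2]
  simp only [smul_apply, smul_eq_mul]
  rw [fderiv_det hW (hpos y hy).isUnit_det, Matrix.trace]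
  simp only [Matrix.diag_apply, Matrix.mul_apply, Matrix.of_apply]
  set T := ∑ d, ∑ e, (formMatrix (ξ y))⁻¹ d e * fderiv ℝ (fun y => formMatrix (ξ y) e d) y v
  have h3 := congrFun hg y
  have hs : Real.sqrt (gram (ξ y)).det ≠ 0 := (Real.sqrt_pos.2 hp).ne'
  have h4 : (matI m).det * ((formMatrix (ξ y)).det * T) =
      Real.sqrt (gram (ξ y)).det * Real.sqrt (gram (ξ y)).det * T := by
    rw [Real.mul_self_sqrt hp.le]
    linear_combination -T * h3
  rw [h4]
  field_simp

/-- The components of the vector field dual to a 1-form, multiplied by the volume density. -/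
def dualField (ξ : Model m → Model m [⋀^Fin 2]→L[ℝ] ℝ) (α : Model m → Model m [⋀^Fin 1]→L[ℝ] ℝ)
    (a : Fin m × Fin 2) (y : Model m) : ℝ :=
  volDensity (ξ y) * ∑ b, (formMatrix (ξ y))⁻¹ a b * α y ![realBasis b]

lemma contDiffOn_dualField (hξ : ContDiffOn ℝ ∞ ξ U) (hpos : ∀ y ∈ U, IsPositiveForm (ξ y))
    (hα : ContDiffOn ℝ ∞ α U) (a) : ContDiffOn ℝ ∞ (dualField ξ α a) U :=
  (contDiffOn_volDensity hξ hpos).mul <| ContDiffOn.sum fun b _ =>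
    (contDiffOn_formMatrix_inv hξ hpos a b).mul (contDiffOn_form_apply hα _)

/-- For a closed positive form, the contraction of an exact 2-form is a divergence. -/
lemma sum_fderiv_dualField (hU : IsOpen U) (hξ : ContDiffOn ℝ ∞ ξ U)
    (hcl : ∀ y ∈ U, extDeriv ξ y = 0) (hpos : ∀ y ∈ U, IsPositiveForm (ξ y))
    (hα : ContDiffOn ℝ ∞ α U) {y : Model m} (hy : y ∈ U) :
    ∑ a, fderiv ℝ (dualField ξ α a) y (realBasis a) =
      -(volDensity (ξ y) * contraction (ξ y) (extDeriv α y)) := by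
  have hn := hU.mem_nhds hy
  have hW : ∀ a b, DifferentiableAt ℝ (fun y => formMatrix (ξ y) a b) y := fun a b =>
    ((contDiffOn_formMatrix hξ a b).contDiffAt hn).differentiableAt (by simp)
  have hP : ∀ a b, DifferentiableAt ℝ (fun y => (formMatrix (ξ y))⁻¹ a b) y := fun a b =>
    ((contDiffOn_formMatrix_inv hξ hpos a b).contDiffAt hn).differentiableAt (by simp)
  have hS : DifferentiableAt ℝ (fun y => volDensity (ξ y)) y :=
    ((contDiffOn_volDensity hξ hpos).contDiffAt hn).differentiableAt (by simp)
  have hαd : DifferentiableAt ℝ α y := (hα.contDiffAt hn).differentiableAt (by simp)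
  have hA : ∀ b : Fin m × Fin 2, DifferentiableAt ℝ (fun y => α y ![realBasis b]) y := fun b =>
    ((contDiffOn_form_apply hα _).contDiffAt hn).differentiableAt (by simp)
  set S := volDensity (ξ y)
  set P := (formMatrix (ξ y))⁻¹ with hPdef
  set dW : Fin m × Fin 2 → Fin m × Fin 2 → Fin m × Fin 2 → ℝ :=
    fun c a b => fderiv ℝ (fun y => formMatrix (ξ y) a b) y (realBasis c) with hdW
  set A : Fin m × Fin 2 → ℝ := fun b => α y ![realBasis b]
  set dA : Fin m × Fin 2 → Fin m × Fin 2 → ℝ :=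
    fun c b => fderiv ℝ (fun y => α y ![realBasis b]) y (realBasis c) with hdA
  have hPanti : ∀ a b, P a b = -P b a := by
    intro a b
    have h1 : (formMatrix (ξ y)).transpose = -formMatrix (ξ y) := by
      ext a b
      exact formMatrix_swap _ _ _
    have h2 : P.transpose = -P := by
      rw [hPdef, Matrix.transpose_nonsing_inv, h1]
      refine Matrix.inv_eq_right_inv ?_
      rw [neg_mul_neg, Matrix.mul_nonsing_inv _ (hpos y hy).isUnit_det]
    exact congrFun (congrFun h2 b) a
  have hWanti : ∀ c a b, dW c a b = -dW c b a := by
    intro c a b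
    have : (fun y => formMatrix (ξ y) a b) = fun y => -formMatrix (ξ y) b a := by
      funext y
      exact formMatrix_swap _ _ _
    simp only [hdW]
    rw [this, fderiv_fun_neg]
    rfl
  have cyc : ∀ a d e, dW a d e - dW d a e + dW e a d = 0 := by
    intro a d e
    have := extDeriv_twoForm ((hξ.contDiffAt hn).differentiableAt (by simp))
      (realBasis a) (realBasis d) (realBasis e)
    rw [hcl y hy] at this
    simp only [hdW, formMatrix_apply]
    exact this.symm
  -- The product rule, with the undifferentiated components `A b` collected. Summed over `a`, their
  -- coefficients vanish by `symplectic_divergence_identity`, and only the derivatives of `α`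
  -- survive.
  have hX : ∀ a, fderiv ℝ (dualField ξ α a) y (realBasis a) = S * ∑ b,
      (((1 / 2) * (∑ d, ∑ e, P d e * dW a e d) * P a b -
        ∑ d, ∑ e, P a d * dW a d e * P e b) * A b + P a b * dA a b) := by
    intro a
    have h1 : HasFDerivAt (dualField ξ α a) _ y := hS.hasFDerivAt.mul
      (HasFDerivAt.fun_sum fun b _ => (hP a b).hasFDerivAt.mul (hA b).hasFDerivAt)
    rw [h1.fderiv]
    simp only [add_apply, smul_apply, sum_apply, smul_eq_mul]
    rw [fderiv_volDensity hU hξ hpos hy]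
    have h2 : ∀ b, fderiv ℝ (fun y => (formMatrix (ξ y))⁻¹ a b) y (realBasis a) =
        -∑ d, ∑ e, P a d * dW a d e * P e b := fun b =>
      fderiv_inv_apply hW hP (by filter_upwards [hn] with z hz using (hpos z hz).isUnit_det) _ a b
    simp only [h2]
    change S * ∑ b, (P a b * dA a b + A b * -∑ d, ∑ e, P a d * dW a d e * P e b) +
      (∑ b, P a b * A b) * (S * ((1 / 2) * ∑ d, ∑ e, P d e * dW a e d)) = _
    generalize ∑ d, ∑ e, P d e * dW a e d = T
    rw [Finset.sum_mul, Finset.mul_sum, Finset.mul_sum, ← Finset.sum_add_distrib]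
    refine Finset.sum_congr rfl fun b _ => ?_
    ring
  simp only [hX]
  rw [← Finset.mul_sum, (hpos y hy).contraction_eq_sum]
  simp only [Finset.sum_add_distrib]
  rw [Finset.sum_comm]
  simp only [← Finset.sum_mul, symplectic_divergence_identity P dW hPanti hWanti cyc, zero_mul,
    Finset.sum_const_zero, zero_add]
  rw [← mul_neg]
  congr 1
  have h3 : ∀ a b, formMatrix (extDeriv α y) a b = dA a b - dA b a := fun a b => by
    rw [formMatrix_apply, extDeriv_oneForm hαd]
  simp only [h3, mul_sub, Finset.sum_sub_distrib]
  have h4 : ∑ a, ∑ b, P a b * dA b a = -∑ a, ∑ b, P a b * dA a b := by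
    rw [Finset.sum_comm, ← Finset.sum_neg_distrib]
    refine Finset.sum_congr rfl fun a _ => ?_
    rw [← Finset.sum_neg_distrib]
    refine Finset.sum_congr rfl fun b _ => ?_
    rw [hPanti b a]; ring
  rw [h4]
  ring

/-- The divergence theorem for the contraction of the differential of a compactly supported
1-form. -/
lemma integral_contraction_extDeriv_eq_zero (hU : IsOpen U) (hξ : ContDiffOn ℝ ∞ ξ U)
    (hcl : ∀ y ∈ U, extDeriv ξ y = 0) (hpos : ∀ y ∈ U, IsPositiveForm (ξ y))
    (hα : ContDiffOn ℝ ∞ α U) {K : Set (Model m)} (hK : IsCompact K) (hKU : K ⊆ U)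
    (h0 : ∀ y ∈ U, y ∉ K → α y = 0) :
    ∫ y in U, volDensity (ξ y) * contraction (ξ y) (extDeriv α y) = 0 := by
  have hd := fun a : Fin m × Fin 2 => integral_fderiv_eq_zero (volume : Measure (Model m)) hU hK hKU
    ((contDiffOn_dualField hξ hpos hα a).of_le (by simp)) (fun y hy hyK => by
      simp [dualField, h0 y hy hyK]) (realBasis a)
  have h1 : ∫ y in U, -(volDensity (ξ y) * contraction (ξ y) (extDeriv α y)) = 0 := by
    rw [← setIntegral_congr_fun hU.measurableSet
      (fun y hy => sum_fderiv_dualField hU hξ hcl hpos hα hy), integral_finsetSum]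
    · exact Finset.sum_eq_zero fun a _ => (hd a).2
    · exact fun a _ => (hd a).1
  rw [integral_neg, neg_eq_zero] at h1
  exact h1

end Divergence

/-! ### Smooth forms on complex manifolds -/

section Charts

variable {m : ℕ} {M : Type*} [TopologicalSpace M] [ChartedSpace (Model m) M]

lemma contDiffOn_transition [IsManifold 𝓘(ℂ, Model m) ω M]
    {c c' : OpenPartialHomeomorph M (Model m)}
    (hc : c ∈ atlas (Model m) M) (hc' : c' ∈ atlas (Model m) M) :
    ContDiffOn ℝ ∞ (c' ∘ c.symm) (c.symm.trans c').source := by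
  have h := HasGroupoid.compatible (G := contDiffGroupoid ω 𝓘(ℂ, Model m)) hc hc'
  have h2 := (mem_groupoid_of_pregroupoid.1 h).1
  have h3 : ContDiffOn ℂ ω (c' ∘ c.symm) (c.symm.trans c').source := by
    simpa [contDiffPregroupoid, Function.comp_def] using h2
  exact (h3.restrict_scalars ℝ).of_le le_top

/-- Sections, gauge transformations and partitions of unity are only real smooth, so the underlying
real manifold is needed. -/
lemma isManifold_real [IsManifold 𝓘(ℂ, Model m) ω M] : IsManifold 𝓘(ℝ, Model m) ∞ M := by
  refine isManifold_of_contDiffOn _ _ _ fun e e' he he' => ?_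
  simpa using contDiffOn_transition he he'

omit [ChartedSpace (Model m) M] in
lemma mem_source_of_mem {c c' : OpenPartialHomeomorph M (Model m)} {y : Model m}
    (hy : y ∈ c.target) (hy' : c.symm y ∈ c'.source) : y ∈ (c.symm.trans c').source := by
  simp [hy, hy']

omit [ChartedSpace (Model m) M] in
lemma mem_source_iff {c c' : OpenPartialHomeomorph M (Model m)} {y : Model m} :
    y ∈ (c.symm.trans c').source ↔ y ∈ c.target ∧ c.symm y ∈ c'.source := by
  simp

variable {p : ℕ} {V : Type*} [NormedAddCommGroup V] [NormedSpace ℝ V] {U : Set M}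
  {α β : LocalForm m M p V}

omit [ChartedSpace (Model m) M] in
lemma isOpen_target_inter (c : OpenPartialHomeomorph M (Model m)) (hU : IsOpen U) :
    IsOpen (c.target ∩ c.symm ⁻¹' U) := c.isOpen_inter_preimage_symm hU

namespace IsSmoothFormOn

lemma congr (h : IsSmoothFormOn U α)
    (hβ : ∀ c ∈ atlas (Model m) M, ∀ y ∈ c.target, c.symm y ∈ U → β c y = α c y) :
    IsSmoothFormOn U β where
  smooth c hc := (h.smooth c hc).congr fun y hy => hβ c hc y hy.1 hy.2
  compat c hc c' hc' y hy hyU := by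
    obtain ⟨h1, h2⟩ := mem_source_iff.1 hy
    rw [hβ c hc y h1 hyU, hβ c' hc' _ (c'.map_source h2) (by rwa [c'.left_inv h2]),
      h.compat c hc c' hc' y hy hyU]

lemma of_local {κ : Type*} {W : κ → Set M} (hW : ∀ i, IsOpen (W i)) (hcov : ∀ x, ∃ i, x ∈ W i)
    (h : ∀ i, IsSmoothFormOn (W i) α) : IsSmoothFormOn Set.univ α where
  smooth c hc y hy := by
    obtain ⟨i, hi⟩ := hcov (c.symm y)
    exact (((h i).smooth c hc).contDiffAt
      ((isOpen_target_inter c (hW i)).mem_nhds ⟨hy.1, hi⟩)).contDiffWithinAt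
  compat c hc c' hc' y hy _ := by
    obtain ⟨i, hi⟩ := hcov (c.symm y)
    exact (h i).compat c hc c' hc' y hy hi

lemma contDiffAt (h : IsSmoothFormOn U α) (hU : IsOpen U) {c : OpenPartialHomeomorph M (Model m)}
    (hc : c ∈ atlas (Model m) M) {y : Model m} (hy : y ∈ c.target) (hyU : c.symm y ∈ U) :
    ContDiffAt ℝ ∞ (α c) y :=
  (h.smooth c hc).contDiffAt ((isOpen_target_inter c hU).mem_nhds ⟨hy, hyU⟩)

lemma differentiableAt (h : IsSmoothFormOn U α) (hU : IsOpen U)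
    {c : OpenPartialHomeomorph M (Model m)} (hc : c ∈ atlas (Model m) M) {y : Model m}
    (hy : y ∈ c.target) (hyU : c.symm y ∈ U) : DifferentiableAt ℝ (α c) y :=
  (h.contDiffAt hU hc hy hyU).differentiableAt (by simp)

lemma sub (h : IsSmoothFormOn U α) (h' : IsSmoothFormOn U β) :
    IsSmoothFormOn U (fun c y => α c y - β c y) where
  smooth c hc := (h.smooth c hc).sub (h'.smooth c hc)
  compat c hc c' hc' y hy hyU := by
    rw [h.compat c hc c' hc' y hy hyU, h'.compat c hc c' hc' y hy hyU]
    rfl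

lemma clm_comp {V' : Type*} [NormedAddCommGroup V'] [NormedSpace ℝ V'] (h : IsSmoothFormOn U α)
    (L : V →L[ℝ] V') : IsSmoothFormOn U (fun c y => L.compContinuousAlternatingMap (α c y)) where
  smooth c hc := (ContinuousLinearMap.compContinuousAlternatingMapCLM
    ℝ (Model m) V V' (Fin p) L).contDiff.comp_contDiffOn (h.smooth c hc)
  compat c hc c' hc' y hy hyU := by
    rw [h.compat c hc c' hc' y hy hyU]
    rfl

/-- The compatibility relation holds on an open set, and `d` commutes with pullback along the
coordinate change. -/
lemma extDeriv [IsManifold 𝓘(ℂ, Model m) ω M] (h : IsSmoothFormOn U α) (hU : IsOpen U) :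
    IsSmoothFormOn U (fun c y => extDeriv (α c) y : LocalForm m M (p + 1) V) where
  smooth c hc := contDiffOn_extDeriv (isOpen_target_inter c hU) (h.smooth c hc)
  compat c hc c' hc' y hy hyU := by
    obtain ⟨h1, h2⟩ := mem_source_iff.1 hy
    have hopen : IsOpen ((c.symm.trans c').source ∩ (c.target ∩ c.symm ⁻¹' U)) :=
      (c.symm.trans c').open_source.inter (isOpen_target_inter c hU)
    have hf : ContDiffAt ℝ ∞ (c' ∘ c.symm) y :=
      (contDiffOn_transition hc hc').contDiffAt ((c.symm.trans c').open_source.mem_nhds hy)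
    have heq : α c =ᶠ[𝓝 y] fun z => (α c' ((c' ∘ c.symm) z)).compContinuousLinearMap
        (fderiv ℝ (c' ∘ c.symm) z) := by
      filter_upwards [hopen.mem_nhds ⟨hy, h1, hyU⟩] with z hz
      exact h.compat c hc c' hc' z hz.1 hz.2.2
    rw [heq.extDeriv_eq]
    refine extDeriv_pullback ?_ (contDiffAt_infty.1 hf 2) (by simp)
    exact h.differentiableAt hU hc' (c'.map_source h2) (by simpa [c'.left_inv h2] using hyU)

end IsSmoothFormOn

namespace KahlerForm

variable (Ω : KahlerForm m M)

lemma isPositiveForm {c : OpenPartialHomeomorph M (Model m)} (hc : c ∈ atlas (Model m) M)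
    {y : Model m} (hy : y ∈ c.target) : IsPositiveForm (Ω.form c y) :=
  ⟨Ω.type_one_one c hc y hy, Ω.positive c hc y hy⟩

lemma contDiffOn_form {c : OpenPartialHomeomorph M (Model m)} (hc : c ∈ atlas (Model m) M) :
    ContDiffOn ℝ ∞ (Ω.form c) c.target := by
  simpa using Ω.smooth.smooth c hc

/-- The contraction of a 2-form with the Kähler form, as a function on the manifold. -/
def contract (η : LocalForm m M 2 ℝ) (x : M) : ℝ :=
  contraction (Ω.form (chartAt (Model m) x) (chartAt (Model m) x x))
    (η (chartAt (Model m) x) (chartAt (Model m) x x))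

variable {Ω} {η : LocalForm m M 2 ℝ}

/-- `contract` uses the preferred chart at each point, which may jump. Invariance under the
derivative of the coordinate change allows one fixed chart to be used near a point, hence
continuity. -/
lemma contract_eq (hη : IsSmoothFormOn U η) {c : OpenPartialHomeomorph M (Model m)}
    (hc : c ∈ atlas (Model m) M) {x : M} (hx : x ∈ c.source) (hxU : x ∈ U) :
    Ω.contract η x = contraction (Ω.form c (c x)) (η c (c x)) := by
  set d := chartAt (Model m) x
  have hd : d ∈ atlas (Model m) M := chart_mem_atlas _ _
  have hxd : x ∈ d.source := mem_chart_source _ _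
  have hy : d x ∈ (d.symm.trans c).source :=
    mem_source_of_mem (d.map_source hxd) (by rwa [d.left_inv hxd])
  have h1 := Ω.smooth.compat d hd c hc (d x) hy trivial
  have h2 := hη.compat d hd c hc (d x) hy (by rwa [d.left_inv hxd])
  rw [d.left_inv hxd] at h1 h2
  rw [contract, h2]
  exact (Ω.isPositiveForm hc (c.map_source hx)).contraction_comp
    (Ω.isPositiveForm hd (d.map_source hxd)) h1 _

lemma continuousOn_contract (hU : IsOpen U) (hη : IsSmoothFormOn U η) :
    ContinuousOn (Ω.contract η) U := by
  intro x hx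
  refine ContinuousAt.continuousWithinAt ?_
  set c := chartAt (Model m) x
  have hc : c ∈ atlas (Model m) M := chart_mem_atlas _ _
  have hxc : x ∈ c.source := mem_chart_source _ _
  have heq : Ω.contract η =ᶠ[𝓝 x]
      (fun y => contraction (Ω.form c y) (η c y)) ∘ c := by
    filter_upwards [c.open_source.mem_nhds hxc, hU.mem_nhds hx] with z hz hzU
    exact contract_eq hη hc hz hzU
  refine ContinuousAt.congr ?_ heq.symm
  refine ContinuousAt.comp ?_ (c.continuousAt hxc)
  have hs := (contDiffOn_contraction ((Ω.contDiffOn_form hc).mono Set.inter_subset_left)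
    (fun y hy => Ω.isPositiveForm hc hy.1) (hη.smooth c hc)).continuousOn
  exact hs.continuousAt ((isOpen_target_inter c hU).mem_nhds
    ⟨c.map_source hxc, by simpa [c.left_inv hxc] using hx⟩)

lemma continuous_contract (hη : IsSmoothFormOn Set.univ η) : Continuous (Ω.contract η) :=
  continuousOn_univ.1 (continuousOn_contract isOpen_univ hη)

end KahlerForm

end Charts

/-! ### The volume measure -/

lemma measurableSet_inter_preimage_of_continuousOn {X Y : Type*} [TopologicalSpace X]
    [MeasurableSpace X] [OpensMeasurableSpace X] [TopologicalSpace Y] [MeasurableSpace Y]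
    [BorelSpace Y] {f : X → Y} {s : Set X} (hf : ContinuousOn f s) (hs : MeasurableSet s)
    {A : Set Y} (hA : MeasurableSet A) : MeasurableSet (s ∩ f ⁻¹' A) := by
  have h1 : Measurable (s.domRestrict f) :=
    (continuousOn_iff_continuous_domRestrict.1 hf).measurable
  rw [← Subtype.image_preimage_coe]
  exact hs.subtype_image (h1 hA)

namespace KahlerForm

variable {m : ℕ} {M : Type*} [TopologicalSpace M] [ChartedSpace (Model m) M]
  [MeasurableSpace M] [BorelSpace M] (Ω : KahlerForm m M)
  {c c' : OpenPartialHomeomorph M (Model m)}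

/-- The volume measure of the domain of a chart. -/
def chartMeasure (c : OpenPartialHomeomorph M (Model m)) : Measure M :=
  (((volume : Measure (Model m)).withDensity
    fun y => ENNReal.ofReal (volDensity (Ω.form c y))).restrict c.target).map c.symm

omit [BorelSpace M] in
lemma vol_eq_iSup : Ω.vol = ⨆ c ∈ atlas (Model m) M, Ω.chartMeasure c := rfl

lemma chartMeasure_apply (c : OpenPartialHomeomorph M (Model m)) {A : Set M}
    (hA : MeasurableSet A) : Ω.chartMeasure c A =
      ∫⁻ y in c.target ∩ c.symm ⁻¹' A, ENNReal.ofReal (volDensity (Ω.form c y)) := by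
  have hm := measurableSet_inter_preimage_of_continuousOn c.continuousOn_symm
    c.open_target.measurableSet hA
  rw [chartMeasure, Measure.map_apply_of_aemeasurable
    (c.continuousOn_symm.aemeasurable c.open_target.measurableSet) hA,
    Measure.restrict_apply' c.open_target.measurableSet, Set.inter_comm, withDensity_apply _ hm]

omit [MeasurableSpace M] [BorelSpace M] in
lemma volDensity_transition [IsManifold 𝓘(ℂ, Model m) ω M] (hc : c ∈ atlas (Model m) M)
    (hc' : c' ∈ atlas (Model m) M) {y : Model m} (hy : y ∈ (c.symm.trans c').source) :
    volDensity (Ω.form c y) =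
      |(fderiv ℝ (c' ∘ c.symm) y).det| * volDensity (Ω.form c' (c' (c.symm y))) := by
  rw [Ω.smooth.compat c hc c' hc' y hy trivial, volDensity, det_gram_comp,
    Real.sqrt_mul (sq_nonneg _), Real.sqrt_sq_eq_abs, volDensity]

/-- The change of variables formula: its Jacobian factor is exactly the one by which the volume
densities differ. -/
lemma chartMeasure_congr [IsManifold 𝓘(ℂ, Model m) ω M] (hc : c ∈ atlas (Model m) M)
    (hc' : c' ∈ atlas (Model m) M) {A : Set M} (hA : MeasurableSet A) (hAc : A ⊆ c.source)
    (hAc' : A ⊆ c'.source) : Ω.chartMeasure c A = Ω.chartMeasure c' A := by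
  rw [Ω.chartMeasure_apply c hA, Ω.chartMeasure_apply c' hA]
  have hm := measurableSet_inter_preimage_of_continuousOn c.continuousOn_symm
    c.open_target.measurableSet hA
  have himage : c'.target ∩ c'.symm ⁻¹' A = (c' ∘ c.symm) '' (c.target ∩ c.symm ⁻¹' A) := by
    ext z
    constructor
    · rintro ⟨hz, hzA⟩
      refine ⟨c (c'.symm z), ⟨c.map_source (hAc hzA), ?_⟩, ?_⟩
      · simpa [c.left_inv (hAc hzA)] using hzA
      · simp [c.left_inv (hAc hzA), c'.right_inv hz]
    · rintro ⟨y, ⟨hy, hyA⟩, rfl⟩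
      refine ⟨c'.map_source (hAc' hyA), ?_⟩
      simpa [c'.left_inv (hAc' hyA)] using hyA
  have hsrc : ∀ y ∈ c.target ∩ c.symm ⁻¹' A, y ∈ (c.symm.trans c').source := fun y hy =>
    mem_source_of_mem hy.1 (hAc' hy.2)
  rw [himage, lintegral_image_eq_lintegral_abs_det_fderiv_mul volume hm
    (f' := fun y => fderiv ℝ (c' ∘ c.symm) y)]
  · refine setLIntegral_congr_fun hm fun y hy => ?_
    rw [Ω.volDensity_transition hc hc' (hsrc y hy), ENNReal.ofReal_mul (abs_nonneg _)]
    rfl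
  · intro y hy
    exact ((((contDiffOn_transition hc hc').contDiffAt
      ((c.symm.trans c').open_source.mem_nhds (hsrc y hy))).differentiableAt
      (by simp)).hasFDerivAt).hasFDerivWithinAt
  · intro y hy z hz hyz
    have h1 := c'.injOn (hAc' hy.2) (hAc' hz.2) hyz
    exact c.symm.injOn hy.1 hz.1 h1

lemma chartMeasure_compl_source (c : OpenPartialHomeomorph M (Model m)) :
    Ω.chartMeasure c c.sourceᶜ = 0 := by
  rw [Ω.chartMeasure_apply c c.open_source.measurableSet.compl]
  have : c.target ∩ c.symm ⁻¹' c.sourceᶜ = ∅ := by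
    ext y
    simp only [Set.mem_inter_iff, Set.mem_preimage, Set.mem_compl_iff, Set.mem_empty_iff_false,
      iff_false, not_and, not_not]
    exact fun hy => c.map_target hy
  rw [this]
  simp

lemma chartMeasure_inter_source (c : OpenPartialHomeomorph M (Model m)) (A : Set M) :
    Ω.chartMeasure c (A ∩ c.source) = Ω.chartMeasure c A :=
  measure_inter_conull (Ω.chartMeasure_compl_source c)

omit [BorelSpace M] in
lemma chartMeasure_le_vol (hc : c ∈ atlas (Model m) M) : Ω.chartMeasure c ≤ Ω.vol :=
  le_iSup₂_of_le c hc le_rfl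

variable [IsManifold 𝓘(ℂ, Model m) ω M]

/-- This justifies glueing by a supremum. Each chart measure agrees with that of `c` on the overlap
and vanishes off its own domain, so the measure of `c` plus the restriction of `Ω.vol` to the
complement of `c.source` bounds all of them. -/
lemma vol_restrict_source (hc : c ∈ atlas (Model m) M) :
    Ω.vol.restrict c.source = Ω.chartMeasure c := by
  have hs := c.open_source.measurableSet
  have hle : Ω.vol ≤ Ω.chartMeasure c + Ω.vol.restrict c.sourceᶜ := by
    rw [vol_eq_iSup]
    refine iSup₂_le fun c' hc' => ?_
    rw [Measure.le_iff]
    intro A hA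
    rw [← measure_inter_add_sdiff A hs, Measure.add_apply, Measure.restrict_apply hA]
    refine add_le_add ?_ (Ω.chartMeasure_le_vol hc' _)
    rw [← Ω.chartMeasure_inter_source c' (A ∩ c.source), Ω.chartMeasure_congr hc' hc
      ((hA.inter hs).inter c'.open_source.measurableSet) Set.inter_subset_right
      (fun x hx => hx.1.2)]
    exact measure_mono fun x hx => hx.1.1
  ext A hA
  rw [Measure.restrict_apply hA]
  refine le_antisymm ?_ ?_
  · refine (hle _).trans ?_
    rw [Measure.add_apply, Measure.restrict_apply (hA.inter hs), Ω.chartMeasure_inter_source]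
    have : A ∩ c.source ∩ c.sourceᶜ = ∅ := by
      ext x; simp
    simp [this]
  · rw [← Ω.chartMeasure_inter_source]
    exact Ω.chartMeasure_le_vol hc _

lemma vol_apply (hc : c ∈ atlas (Model m) M) {A : Set M} (hA : MeasurableSet A)
    (hAc : A ⊆ c.source) : Ω.vol A =
      ∫⁻ y in c.target ∩ c.symm ⁻¹' A, ENNReal.ofReal (volDensity (Ω.form c y)) := by
  rw [← Ω.chartMeasure_apply c hA, ← Ω.vol_restrict_source hc, Measure.restrict_eq_self _ hAc]

omit [MeasurableSpace M] [BorelSpace M] [IsManifold 𝓘(ℂ, Model m) ω M] in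
lemma continuousOn_volDensity (hc : c ∈ atlas (Model m) M) :
    ContinuousOn (fun y => volDensity (Ω.form c y)) c.target :=
  (contDiffOn_volDensity (Ω.contDiffOn_form hc) fun _ hy =>
    Ω.isPositiveForm hc hy).continuousOn

/-- The density is positive in every chart. This gives positive total volume, and positive volume to
the set where a component of `φ` does not vanish. -/
instance isOpenPosMeasure_vol : Ω.vol.IsOpenPosMeasure := by
  refine ⟨fun U hU hne h0 => ?_⟩
  obtain ⟨x, hx⟩ := hne
  set c := chartAt (Model m) x
  have hc : c ∈ atlas (Model m) M := chart_mem_atlas _ _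
  have hxc : x ∈ c.source := mem_chart_source _ _
  have hU' : IsOpen (U ∩ c.source) := hU.inter c.open_source
  have h1 : Ω.vol (U ∩ c.source) = 0 := measure_mono_null Set.inter_subset_left h0
  have hW := isOpen_target_inter c hU'
  rw [Ω.vol_apply hc hU'.measurableSet Set.inter_subset_right,
    lintegral_eq_zero_iff' (((Ω.continuousOn_volDensity hc).mono
      Set.inter_subset_left).aemeasurable hW.measurableSet).ennreal_ofReal,
    Filter.EventuallyEq, ae_restrict_iff' hW.measurableSet] at h1
  have h2 : (volume : Measure (Model m)) (c.target ∩ c.symm ⁻¹' (U ∩ c.source)) = 0 := by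
    refine measure_mono_null (fun y hy => ?_) h1
    simp only [Set.mem_compl_iff, Set.mem_ofPred_eq]
    intro h
    have := h hy
    simp only [Pi.zero_apply, ENNReal.ofReal_eq_zero] at this
    exact absurd (Ω.isPositiveForm hc hy.1).volDensity_pos (not_lt.2 this)
  exact (hW.measure_pos _ ⟨c x, c.map_source hxc, by simp [c.left_inv hxc, hx, hxc]⟩).ne' h2

/-- The density is locally bounded in a chart. On compact `M` the volume is then finite and
continuous functions are integrable. -/
instance isLocallyFiniteMeasure_vol : IsLocallyFiniteMeasure Ω.vol := by
  refine ⟨fun x => ?_⟩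
  set c := chartAt (Model m) x
  have hc : c ∈ atlas (Model m) M := chart_mem_atlas _ _
  have hxc : x ∈ c.source := mem_chart_source _ _
  have hct := (Ω.continuousOn_volDensity hc).continuousAt
    (c.open_target.mem_nhds (c.map_source hxc))
  obtain ⟨K, hK, hKn⟩ := exists_compact_mem_nhds (c x)
  set C := volDensity (Ω.form c (c x)) + 1
  have hev : ∀ᶠ y in 𝓝 (c x), volDensity (Ω.form c y) < C ∧ y ∈ K :=
    (hct.eventually_lt_const (lt_add_one _)).and hKn
  obtain ⟨W, hWsub, hWo, hxW⟩ := eventually_nhds_iff.1 hev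
  have hAo : IsOpen (c.source ∩ c ⁻¹' W) := c.isOpen_inter_preimage hWo
  refine ⟨c.source ∩ c ⁻¹' W, hAo.mem_nhds ⟨hxc, hxW⟩, ?_⟩
  rw [Ω.vol_apply hc hAo.measurableSet Set.inter_subset_left]
  have hsub : ∀ y ∈ c.target ∩ c.symm ⁻¹' (c.source ∩ c ⁻¹' W), y ∈ W := fun y hy => by
    simpa [c.right_inv hy.1] using hy.2.2
  calc _ ≤ ∫⁻ y in c.target ∩ c.symm ⁻¹' (c.source ∩ c ⁻¹' W), ENNReal.ofReal C :=
        setLIntegral_mono' (isOpen_target_inter c hAo).measurableSet fun y hy =>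
          ENNReal.ofReal_le_ofReal (hWsub y (hsub y hy)).1.le
    _ = ENNReal.ofReal C * volume (c.target ∩ c.symm ⁻¹' (c.source ∩ c ⁻¹' W)) := by
        rw [setLIntegral_const]
    _ < ⊤ := ENNReal.mul_lt_top ENNReal.ofReal_lt_top
        ((measure_mono fun y hy => (hWsub y (hsub y hy)).2).trans_lt hK.measure_lt_top)

lemma totalVol_pos [CompactSpace M] [Nonempty M] : 0 < Ω.totalVol :=
  ENNReal.toReal_pos (isOpen_univ.measure_ne_zero _ Set.univ_nonempty) (measure_ne_top _ _)

lemma setIntegral_source (hc : c ∈ atlas (Model m) M) {f : M → ℝ} (hf : Continuous f) :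
    ∫ x in c.source, f x ∂Ω.vol = ∫ y in c.target, volDensity (Ω.form c y) * f (c.symm y) := by
  have ht := c.open_target.measurableSet
  rw [Ω.vol_restrict_source hc, chartMeasure, integral_map
    (c.continuousOn_symm.aemeasurable ht) hf.measurable.aestronglyMeasurable,
    restrict_withDensity ht, integral_withDensity_eq_integral_toReal_smul₀
    (((Ω.continuousOn_volDensity hc).aemeasurable ht).ennreal_ofReal) (by simp)]
  refine setIntegral_congr_fun ht fun y hy => ?_
  simp only [smul_eq_mul]
  rw [ENNReal.toReal_ofReal (Ω.isPositiveForm hc hy).volDensity_pos.le]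

end KahlerForm

/-! ### Stokes' theorem for the contraction of exact forms -/

section Stokes

lemma extDeriv_fun_sum {E V κ : Type*} [NormedAddCommGroup E] [NormedSpace ℝ E]
    [NormedAddCommGroup V] [NormedSpace ℝ V] {p : ℕ} (t : Finset κ)
    {α : κ → E → E [⋀^Fin p]→L[ℝ] V} {y : E} (h : ∀ i ∈ t, DifferentiableAt ℝ (α i) y) :
    extDeriv (fun y => ∑ i ∈ t, α i y) y = ∑ i ∈ t, extDeriv (α i) y := by
  have h1 : fderiv ℝ (fun y => ∑ i ∈ t, α i y) y = ∑ i ∈ t, fderiv ℝ (α i) y := fderiv_fun_sum h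
  simp only [extDeriv]
  rw [h1]
  exact map_sum (ContinuousAlternatingMap.alternatizeUncurryFinCLM ℝ E V) _ _

lemma extDeriv_clm_comp {E V V' : Type*} [NormedAddCommGroup E] [NormedSpace ℝ E]
    [NormedAddCommGroup V] [NormedSpace ℝ V] [NormedAddCommGroup V'] [NormedSpace ℝ V'] {p : ℕ}
    {α : E → E [⋀^Fin p]→L[ℝ] V} {y : E} (h : DifferentiableAt ℝ α y) (L : V →L[ℝ] V') :
    extDeriv (fun y => L.compContinuousAlternatingMap (α y)) y =
      L.compContinuousAlternatingMap (extDeriv α y) := by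
  have h1 : DifferentiableAt ℝ (fun y => L.compContinuousAlternatingMap (α y)) y :=
    (ContinuousLinearMap.compContinuousAlternatingMapCLM ℝ E V V' (Fin p)
      L).differentiableAt.comp y h
  ext v
  rw [extDeriv_apply h1, ContinuousLinearMap.compContinuousAlternatingMap_coe,
    Function.comp_apply, extDeriv_apply h, map_sum]
  refine Finset.sum_congr rfl fun i _ => ?_
  have h2 : HasFDerivAt (fun x => L (α x (i.removeNth v)))
      (L.comp (fderiv ℝ (fun x => α x (i.removeNth v)) y)) y :=
    L.hasFDerivAt.comp y
      (((ContinuousAlternatingMap.apply ℝ E V (i.removeNth v)).differentiableAt.comp y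
        h).hasFDerivAt)
  have h3 := h2.fderiv
  rw [map_zsmul]
  congr 1
  exact congrArg (fun F => F (v i)) h3

variable {m : ℕ} {M : Type*} [TopologicalSpace M] [ChartedSpace (Model m) M]
  [IsManifold 𝓘(ℂ, Model m) ω M]

lemma contDiffOn_comp_symm {F : Type*} [NormedAddCommGroup F] [NormedSpace ℝ F] {f : M → F}
    {U : Set M} (hf : ContMDiffOn 𝓘(ℝ, Model m) 𝓘(ℝ, F) ∞ f U)
    {c : OpenPartialHomeomorph M (Model m)} (hc : c ∈ atlas (Model m) M) :
    ContDiffOn ℝ ∞ (fun y => f (c.symm y)) (c.target ∩ c.symm ⁻¹' U) := by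
  have : IsManifold 𝓘(ℝ, Model m) ∞ M := isManifold_real
  rw [← contMDiffOn_iff_contDiffOn]
  refine hf.comp ((contMDiffOn_symm_of_mem_maximalAtlas
    (IsManifold.subset_maximalAtlas hc)).mono Set.inter_subset_left) Set.inter_subset_right

lemma IsSmoothFormOn.smul {p : ℕ} {V : Type*} [NormedAddCommGroup V] [NormedSpace ℝ V]
    {α : LocalForm m M p V} {U : Set M} (hα : IsSmoothFormOn U α) {f : M → ℝ}
    (hf : ContMDiffOn 𝓘(ℝ, Model m) 𝓘(ℝ, ℝ) ∞ f U) :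
    IsSmoothFormOn U (fun c y => f (c.symm y) • α c y) where
  smooth c hc := (contDiffOn_comp_symm hf hc).smul (hα.smooth c hc)
  compat c hc c' hc' y hy hyU := by
    obtain ⟨h1, h2⟩ := mem_source_iff.1 hy
    rw [hα.compat c hc c' hc' y hy hyU, c'.left_inv h2]
    rfl

variable [MeasurableSpace M] [BorelSpace M] [CompactSpace M] (Ω : KahlerForm m M)

lemma KahlerForm.integrable_of_continuous {f : M → ℝ} (hf : Continuous f) :
    Integrable f Ω.vol :=
  hf.integrable_of_hasCompactSupport (HasCompactSupport.of_compactSpace f)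

/-- For `β` supported in a single chart domain the integrand vanishes elsewhere, and the claim
becomes the Euclidean divergence theorem. -/
lemma integral_contract_extDeriv_of_support {β : LocalForm m M 1 ℝ}
    (hβ : IsSmoothFormOn Set.univ β) {c : OpenPartialHomeomorph M (Model m)}
    (hc : c ∈ atlas (Model m) M) {K : Set M} (hK : IsClosed K) (hKc : K ⊆ c.source)
    (h0 : ∀ c' ∈ atlas (Model m) M, ∀ y ∈ c'.target, c'.symm y ∉ K → β c' y = 0) :
    ∫ x, Ω.contract (fun c y => extDeriv (β c) y) x ∂Ω.vol = 0 := by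
  have hdβ : IsSmoothFormOn Set.univ (fun c y => extDeriv (β c) y : LocalForm m M 2 ℝ) :=
    hβ.extDeriv isOpen_univ
  have hvanish : ∀ x ∉ c.source, Ω.contract (fun c y => extDeriv (β c) y) x = 0 := by
    intro x hx
    set d := chartAt (Model m) x
    have hxd : x ∈ d.source := mem_chart_source _ _
    have h1 : β d =ᶠ[𝓝 (d x)] fun _ => 0 := by
      filter_upwards [(isOpen_target_inter d hK.isOpen_compl).mem_nhds
        ⟨d.map_source hxd, by
          simp only [Set.mem_preimage, d.left_inv hxd]
          exact fun h => hx (hKc h)⟩] with z hz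
      exact h0 d (chart_mem_atlas _ _) z hz.1 hz.2
    have h2 : extDeriv (β d) (d x) = 0 := by
      rw [h1.extDeriv_eq]
      ext v
      simp [extDeriv, ContinuousAlternatingMap.alternatizeUncurryFin_apply]
    change contraction _ (extDeriv (β d) (d x)) = 0
    rw [h2]
    simp [contraction, formInner]
  rw [← setIntegral_eq_integral_of_forall_compl_eq_zero hvanish,
    Ω.setIntegral_source hc (KahlerForm.continuous_contract hdβ)]
  have hKt : c '' K ⊆ c.target := by
    rintro _ ⟨x, hx, rfl⟩
    exact c.map_source (hKc hx)
  rw [← integral_contraction_extDeriv_eq_zero c.open_target (Ω.contDiffOn_form hc)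
    (Ω.closed c hc) (fun y hy => Ω.isPositiveForm hc hy) (by simpa using hβ.smooth c hc)
    (hK.isCompact.image_of_continuousOn (c.continuousOn.mono hKc)) hKt ?_]
  · refine setIntegral_congr_fun c.open_target.measurableSet fun y hy => ?_
    rw [KahlerForm.contract_eq hdβ hc (c.map_target hy) trivial, c.right_inv hy]
  · intro y hy hyK
    exact h0 c hc y hy fun h => hyK ⟨_, h, c.right_inv hy⟩

/-- On a compact Kähler manifold the contraction of an exact 2-form has vanishing integral. -/
theorem integral_contract_extDeriv [T2Space M] {β : LocalForm m M 1 ℝ}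
    (hβ : IsSmoothFormOn Set.univ β) :
    ∫ x, Ω.contract (fun c y => extDeriv (β c) y) x ∂Ω.vol = 0 := by
  have : IsManifold 𝓘(ℝ, Model m) ∞ M := isManifold_real
  obtain ⟨t, ht⟩ := CompactSpace.elim_nhds_subcover
    (fun x : M => (chartAt (Model m) x).source) (fun x => (chartAt (Model m) x).open_source.mem_nhds
      (mem_chart_source _ _))
  obtain ⟨ρ, hρ⟩ := SmoothPartitionOfUnity.exists_isSubordinate 𝓘(ℝ, Model m)
    (isClosed_univ : IsClosed (Set.univ : Set M))
    (fun i : t => (chartAt (Model m) (i : M)).source) (fun i => (chartAt (Model m) _).open_source)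
    (by
      intro x _
      have hx : x ∈ ⋃ y ∈ t, (chartAt (Model m) y).source := by rw [ht]; trivial
      simpa using hx)
  -- Only the sum of the pieces is differentiated back to `dβ`, so no derivative of `ρ` ever has to
  -- be computed.
  let β' : t → LocalForm m M 1 ℝ := fun i c y => ρ i (c.symm y) • β c y
  have hβ' : ∀ i, IsSmoothFormOn Set.univ (β' i) := fun i =>
    hβ.smul (ρ i).contMDiff.contMDiffOn
  have hsum : ∀ x, Ω.contract (fun c y => extDeriv (β c) y) x =
      ∑ i, Ω.contract (fun c y => extDeriv (β' i c) y) x := by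
    intro x
    simp only [KahlerForm.contract]
    rw [← contraction_sum, ← extDeriv_fun_sum]
    · congr 1
      refine Filter.EventuallyEq.extDeriv_eq (Filter.Eventually.of_forall fun z => ?_)
      simp only [β']
      rw [← Finset.sum_smul, ← finsum_eq_sum_of_fintype, ρ.sum_eq_one (Set.mem_univ _), one_smul]
    · intro i _
      exact (hβ' i).differentiableAt isOpen_univ (chart_mem_atlas _ _)
        (mem_chart_target _ _) trivial
  simp only [hsum]
  rw [integral_finsetSum]
  · refine Finset.sum_eq_zero fun i _ => ?_
    refine integral_contract_extDeriv_of_support Ω (hβ' i) (chart_mem_atlas _ (i : M))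
      (isClosed_tsupport (ρ i)) (hρ i) fun c' _ y _ hy => ?_
    simp only [β']
    rw [image_eq_zero_of_notMem_tsupport hy, zero_smul]
  · exact fun i _ => Ω.integrable_of_continuous
      (KahlerForm.continuous_contract ((hβ' i).extDeriv isOpen_univ))

end Stokes

/-! ### The curvature of a connection as a global form -/

/-- The map `z ↦ Re (i z)`. -/
def reI : ℂ →L[ℝ] ℝ := Complex.reCLM.comp (Complex.I • ContinuousLinearMap.id ℝ ℂ)

lemma oneForm_ext {E V : Type*} [NormedAddCommGroup E] [NormedSpace ℝ E] [NormedAddCommGroup V]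
    [NormedSpace ℝ V] {α β : E [⋀^Fin 1]→L[ℝ] V} (h : ∀ v, α ![v] = β ![v]) : α = β := by
  ext v
  have : v = ![v 0] := by ext i; fin_cases i; rfl
  rw [this, h]

lemma twoForm_ext {E V : Type*} [NormedAddCommGroup E] [NormedSpace ℝ E] [NormedAddCommGroup V]
    [NormedSpace ℝ V] {α β : E [⋀^Fin 2]→L[ℝ] V} (h : ∀ v w, α ![v, w] = β ![v, w]) : α = β := by
  ext v
  have : v = ![v 0, v 1] := by ext i; fin_cases i <;> rfl
  rw [this, h]

/-- The logarithmic derivative of a smooth function is a closed form. -/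
lemma extDeriv_logDeriv_eq_zero {E : Type*} [NormedAddCommGroup E] [NormedSpace ℝ E]
    {θ : E → E [⋀^Fin 1]→L[ℝ] ℂ} {g : E → ℂ} {y : E} (hθ : DifferentiableAt ℝ θ y)
    (hg : ContDiffAt ℝ ∞ g y) (hg0 : g y ≠ 0)
    (h : ∀ᶠ z in 𝓝 y, ∀ v, θ z ![v] = (g z)⁻¹ * fderiv ℝ g z v) : extDeriv θ y = 0 := by
  refine twoForm_ext fun v w => ?_
  have hg2 : ContDiffAt ℝ 2 g y := contDiffAt_infty.1 hg 2
  have hgd : HasFDerivAt g (fderiv ℝ g y) y := (hg2.differentiableAt (by simp)).hasFDerivAt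
  have hdg : DifferentiableAt ℝ (fderiv ℝ g) y :=
    (hg2.fderiv_right (m := 1) (by norm_num)).differentiableAt (by simp)
  have hsymm : IsSymmSndFDerivAt ℝ g y := hg2.isSymmSndFDerivAt (by simp)
  have key : ∀ u, HasFDerivAt (fun z => θ z ![u])
      ((g y)⁻¹ • ((ContinuousLinearMap.apply ℝ ℂ u).comp (fderiv ℝ (fderiv ℝ g) y)) +
        fderiv ℝ g y u • (-(g y ^ 2)⁻¹ • fderiv ℝ g y)) y := by
    intro u
    have h1 : HasFDerivAt (fun z => (g z)⁻¹) (-(g y ^ 2)⁻¹ • fderiv ℝ g y) y := by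
      have h0 := ((hasDerivAt_inv hg0).hasFDerivAt.restrictScalars ℝ).comp y hgd
      refine h0.congr_fderiv ?_
      ext z
      simp [mul_comm]
    have h2 : HasFDerivAt (fun z => fderiv ℝ g z u)
        ((ContinuousLinearMap.apply ℝ ℂ u).comp (fderiv ℝ (fderiv ℝ g) y)) y :=
      (ContinuousLinearMap.apply ℝ ℂ u).hasFDerivAt.comp y hdg.hasFDerivAt
    refine (h1.mul h2).congr_of_eventuallyEq ?_
    filter_upwards [h] with z hz using hz u
  rw [extDeriv_oneForm hθ, (key w).fderiv, (key v).fderiv]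
  simp only [add_apply, smul_apply, ContinuousLinearMap.comp_apply,
    ContinuousLinearMap.apply_apply, smul_eq_mul]
  -- Both `g⁻¹ d²g` and `g⁻² dg ⊗ dg` are symmetric, so antisymmetrization kills them.
  rw [hsymm.eq v w]
  simp only [ContinuousAlternatingMap.coe_zero, Pi.zero_apply]
  ring

section Curvature

variable {ι : Type*} {m k n : ℕ} {M : Type*} [TopologicalSpace M] [ChartedSpace (Model m) M]
  [IsManifold 𝓘(ℂ, Model m) ω M] {P : TorusBundle ι m k M}

namespace Connection

variable (A B : Connection P)

lemma isSmoothFormOn_curvature (i : ι) (a : Fin k) :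
    IsSmoothFormOn (P.U i) (A.curvature i a) :=
  (A.smooth i a).extDeriv (P.isOpen_U i)

lemma isSmoothFormOn_iF (i : ι) (a : Fin k) : IsSmoothFormOn (P.U i) (A.iF i a) :=
  ((A.isSmoothFormOn_curvature i a).clm_comp reI).congr fun c _ y _ _ => by
    ext v
    simp [iF, reI]

/-- The two local connection forms differ by the logarithmic derivative of `g i j`, which is closed.
-/
lemma curvature_eq {i j : ι} (a : Fin k) {c : OpenPartialHomeomorph M (Model m)}
    (hc : c ∈ atlas (Model m) M) {y : Model m} (hy : y ∈ c.target)
    (hi : c.symm y ∈ P.U i) (hj : c.symm y ∈ P.U j) :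
    A.curvature i a c y = A.curvature j a c y := by
  have hAi := (A.smooth i a).differentiableAt (P.isOpen_U i) hc hy hi
  have hAj := (A.smooth j a).differentiableAt (P.isOpen_U j) hc hy hj
  have hij : IsOpen (P.U i ∩ P.U j) := (P.isOpen_U i).inter (P.isOpen_U j)
  have hn := (isOpen_target_inter c hij).mem_nhds ⟨hy, hi, hj⟩
  have h0 : extDeriv (fun z => A.A j a c z - A.A i a c z) y = 0 := by
    refine extDeriv_logDeriv_eq_zero (g := fun z => (P.g i j (c.symm z) a : ℂ)) (hAj.sub hAi)
      ((contDiffOn_comp_symm (P.smooth i j a) hc).contDiffAt hn) (Circle.coe_ne_zero _) ?_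
    filter_upwards [hn] with z hz v
    rw [ContinuousAlternatingMap.sub_apply, A.transition i j a c hc z hz.1 hz.2 v]
    ring
  have h1 : extDeriv (fun z => A.A j a c z - A.A i a c z) y =
      extDeriv (A.A j a c) y - extDeriv (A.A i a c) y := by
    simp only [extDeriv]
    rw [fderiv_fun_sub hAj hAi]
    exact map_sub (ContinuousAlternatingMap.alternatizeUncurryFinCLM ℝ (Model m) ℂ) _ _
  rw [h1, sub_eq_zero] at h0
  exact h0.symm

/-- The 2-form `i F_A` as a globally defined form. -/
def globalIF (a : Fin k) : LocalForm m M 2 ℝ := fun c y => A.iF (P.indexAt (c.symm y)) a c y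

/-- The trivialization chosen at a point may jump, but `curvature_eq` allows the index to be frozen
on each `P.U i`. -/
lemma isSmoothFormOn_globalIF (a : Fin k) : IsSmoothFormOn Set.univ (A.globalIF a) := by
  refine IsSmoothFormOn.of_local P.isOpen_U (fun x => ⟨_, P.mem_indexAt x⟩) fun i => ?_
  refine (A.isSmoothFormOn_iF i a).congr fun c hc y hy hi => ?_
  simp only [globalIF, iF]
  rw [A.curvature_eq a hc hy (P.mem_indexAt _) hi]

omit [IsManifold 𝓘(ℂ, Model m) ω M] in
lemma iLambdaF_apply (Ω : KahlerForm m M) (a : Fin k) (x : M) :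
    iLambdaF Ω A x a = Ω.contract (A.globalIF a) x := by
  simp [iLambdaF, KahlerForm.contract, globalIF]

/-- The difference of two connections, multiplied by `i`, as a global real 1-form. -/
def diffForm (a : Fin k) : LocalForm m M 1 ℝ := fun c y =>
  reI.compContinuousAlternatingMap
    (A.A (P.indexAt (c.symm y)) a c y - B.A (P.indexAt (c.symm y)) a c y)

-- The inhomogeneous terms `g⁻¹ dg` of the two connections cancel in the difference.
omit [IsManifold 𝓘(ℂ, Model m) ω M] in
lemma diffForm_eq {i : ι} (a : Fin k) {c : OpenPartialHomeomorph M (Model m)}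
    (hc : c ∈ atlas (Model m) M) {y : Model m} (hy : y ∈ c.target) (hi : c.symm y ∈ P.U i) :
    A.diffForm B a c y = reI.compContinuousAlternatingMap (A.A i a c y - B.A i a c y) := by
  rw [diffForm]
  congr 1
  refine oneForm_ext fun v => ?_
  have h := And.intro (P.mem_indexAt (c.symm y)) hi
  rw [ContinuousAlternatingMap.sub_apply, ContinuousAlternatingMap.sub_apply,
    A.transition _ _ a c hc y hy h v, B.transition _ _ a c hc y hy h v]
  ring

omit [IsManifold 𝓘(ℂ, Model m) ω M] in
lemma isSmoothFormOn_diffForm (a : Fin k) : IsSmoothFormOn Set.univ (A.diffForm B a) := by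
  refine IsSmoothFormOn.of_local P.isOpen_U (fun x => ⟨_, P.mem_indexAt x⟩) fun i => ?_
  exact (((A.smooth i a).sub (B.smooth i a)).clm_comp reI).congr
    fun c hc y hy hi => A.diffForm_eq B a hc hy hi

omit [IsManifold 𝓘(ℂ, Model m) ω M] in
lemma extDeriv_diffForm (a : Fin k) {c : OpenPartialHomeomorph M (Model m)}
    (hc : c ∈ atlas (Model m) M) {y : Model m} (hy : y ∈ c.target) :
    extDeriv (A.diffForm B a c) y = A.globalIF a c y - B.globalIF a c y := by
  set i := P.indexAt (c.symm y)
  have hi : c.symm y ∈ P.U i := P.mem_indexAt _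
  have hA := (A.smooth i a).differentiableAt (P.isOpen_U i) hc hy hi
  have hB := (B.smooth i a).differentiableAt (P.isOpen_U i) hc hy hi
  have h1 : A.diffForm B a c =ᶠ[𝓝 y] fun z =>
      reI.compContinuousAlternatingMap (A.A i a c z - B.A i a c z) := by
    filter_upwards [(isOpen_target_inter c (P.isOpen_U i)).mem_nhds ⟨hy, hi⟩] with z hz
    exact A.diffForm_eq B a hc hz.1 hz.2
  have h2 : extDeriv (fun z => A.A i a c z - B.A i a c z) y =
      extDeriv (A.A i a c) y - extDeriv (B.A i a c) y := by
    simp only [extDeriv]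
    rw [fderiv_fun_sub hA hB]
    exact map_sub (ContinuousAlternatingMap.alternatizeUncurryFinCLM ℝ (Model m) ℂ) _ _
  rw [h1.extDeriv_eq,
    extDeriv_clm_comp (α := fun z => A.A i a c z - B.A i a c z) (hA.sub hB), h2]
  ext v
  simp [globalIF, iF, curvature, reI, i]
  ring

variable [MeasurableSpace M] [BorelSpace M] [CompactSpace M] [T2Space M] (Ω : KahlerForm m M)

omit [MeasurableSpace M] [BorelSpace M] [CompactSpace M] [T2Space M] in
lemma continuous_iLambdaF_apply (a : Fin k) : Continuous fun x => iLambdaF Ω A x a := by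
  simp only [iLambdaF_apply]
  exact KahlerForm.continuous_contract (A.isSmoothFormOn_globalIF a)

omit [MeasurableSpace M] [BorelSpace M] [CompactSpace M] [T2Space M] in
lemma continuous_iLambdaF : Continuous (iLambdaF Ω A) := by
  refine (PiLp.continuous_toLp 2 _).comp (continuous_pi fun a => ?_)
  exact A.continuous_iLambdaF_apply Ω a

/-- The integral of `i Λ F_A` does not depend on the connection. -/
theorem integral_iLambdaF_eq (a : Fin k) :
    ∫ x, iLambdaF Ω A x a ∂Ω.vol = ∫ x, iLambdaF Ω B x a ∂Ω.vol := by
  rw [← sub_eq_zero, ← integral_sub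
    (Ω.integrable_of_continuous (A.continuous_iLambdaF_apply Ω a))
    (Ω.integrable_of_continuous (B.continuous_iLambdaF_apply Ω a)),
    ← integral_contract_extDeriv Ω (A.isSmoothFormOn_diffForm B a)]
  congr 1
  funext x
  rw [iLambdaF_apply, iLambdaF_apply, KahlerForm.contract, KahlerForm.contract,
    KahlerForm.contract, A.extDeriv_diffForm B a (chart_mem_atlas _ _) (mem_chart_target _ _),
    sub_eq_add_neg _ (B.globalIF _ _ _), contraction_add, ← neg_one_smul ℝ, contraction_smul]
  ring

end Connection

variable [MeasurableSpace M] [BorelSpace M] [CompactSpace M] [T2Space M] (Ω : KahlerForm m M)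

-- The quotient defining `chernParallel` is `(1 / 2π) ∫ iΛF` over `m Vol M`, so the constants in `σ`
-- cancel and leave `e⁻² ∫ iΛF`.
omit [T2Space M] in
lemma stabilityVector_apply [Nonempty M] {e : ℝ} (he : 0 < e) (τ : RVec k) (B : Connection P)
    (a : Fin k) : e ^ 2 * stabilityVector Ω e τ B a =
      e ^ 2 * (τ a * Ω.totalVol) - ∫ x, iLambdaF Ω B x a ∂Ω.vol := by
  have hnum : ∫ x, formInner (Ω.form (chartAt (Model m) x) (chartAt (Model m) x x))
      (chernForm B (P.indexAt x) a (chartAt (Model m) x) (chartAt (Model m) x x))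
      (Ω.form (chartAt (Model m) x) (chartAt (Model m) x x)) ∂Ω.vol =
      (1 / (2 * Real.pi)) * ∫ x, iLambdaF Ω B x a ∂Ω.vol := by
    rw [← integral_const_mul]
    congr 1
    funext x
    exact contraction_smul _ _ _
  have hden : ∫ x, formInner (Ω.form (chartAt (Model m) x) (chartAt (Model m) x x))
      (Ω.form (chartAt (Model m) x) (chartAt (Model m) x x))
      (Ω.form (chartAt (Model m) x) (chartAt (Model m) x x)) ∂Ω.vol = Ω.totalVol * m := by
    have h1 : ∀ x : M, formInner (Ω.form (chartAt (Model m) x) (chartAt (Model m) x x))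
      (Ω.form (chartAt (Model m) x) (chartAt (Model m) x x))
      (Ω.form (chartAt (Model m) x) (chartAt (Model m) x x)) = m := fun x =>
        (Ω.isPositiveForm (chart_mem_atlas _ _) (mem_chart_target _ _)).contraction_self
    simp only [h1, integral_const, smul_eq_mul, KahlerForm.totalVol]
  have hV := Ω.totalVol_pos.ne'
  change e ^ 2 * (τ a * Ω.totalVol -
    (2 * Real.pi * m / e ^ 2) * chernParallel Ω B a * Ω.totalVol) = _
  rw [chernParallel, hnum, hden]
  -- For `m = 0` the denominator `m Vol M` vanishes; the explicit factor `m` kills the Chern term,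
  -- and `iΛF` is an empty sum.
  rcases Nat.eq_zero_or_pos m with hm | hm
  · subst hm
    have : ∀ x, iLambdaF Ω B x a = 0 := fun x => by
      simp [iLambdaF, contraction, formInner]
    simp [this]
  · have hm' : (m : ℝ) ≠ 0 := by positivity
    field_simp

end Curvature

/-! ### The maximal weights of the torus action -/

section MaxWeight

variable {n k : ℕ} (Q : Fin n → Fin k → ℤ) (τ v : RVec k)

lemma momentComponent_eq (z : EuclideanSpace ℂ (Fin n)) : momentComponent Q τ v z =
    (1 / 2) * inner ℝ v τ + ∑ j, -(1 / 2) * inner ℝ v (weight Q j) * ‖z j‖ ^ 2 := by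
  rw [momentComponent, momentMap, inner_smul_right, inner_sub_right, inner_sum, mul_sub,
    Finset.mul_sum, sub_eq_neg_add]
  congr 1
  · ring
  · refine Finset.sum_congr rfl fun j _ => ?_
    rw [inner_smul_right]
    ring

/-- The gradient of a component of the moment map. -/
lemma gradient_momentComponent (z : EuclideanSpace ℂ (Fin n)) :
    gradient (momentComponent Q τ v) z =
      WithLp.toLp 2 fun j => (-(inner ℝ v (weight Q j) : ℝ)) • z j := by
  refine HasGradientAt.gradient ?_
  rw [hasGradientAt_iff_hasFDerivAt]
  have h1 : ∀ j, HasFDerivAt (fun z : EuclideanSpace ℂ (Fin n) => ‖z j‖ ^ 2)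
      ((2 • innerSL ℝ (z j)).comp (PiLp.proj (𝕜 := ℝ) 2 (fun _ : Fin n => ℂ) j)) z := fun j =>
    HasFDerivAt.comp (g := fun w : ℂ => ‖w‖ ^ 2) z (hasStrictFDerivAt_norm_sq (z j)).hasFDerivAt
      (PiLp.proj (𝕜 := ℝ) 2 (fun _ : Fin n => ℂ) j).hasFDerivAt
  have h2 : HasFDerivAt (momentComponent Q τ v) _ z :=
    ((HasFDerivAt.fun_sum fun j (_ : j ∈ Finset.univ) =>
      (h1 j).const_mul (-(1 / 2) * inner ℝ v (weight Q j))).const_add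
        ((1 / 2) * inner ℝ v τ)).congr_of_eventuallyEq
        (Filter.Eventually.of_forall fun z => momentComponent_eq Q τ v z)
  refine h2.congr_fderiv ?_
  ext u
  simp only [sum_apply, smul_apply, ContinuousLinearMap.comp_apply, PiLp.proj_apply,
    innerSL_apply_apply, smul_eq_mul, InnerProductSpace.toDual_apply_apply, PiLp.inner_apply]
  refine Finset.sum_congr rfl fun j _ => ?_
  rw [real_inner_smul_left, nsmul_eq_mul]
  push_cast
  ring

/-- The explicit gradient flow. -/
def explicitFlow (z : EuclideanSpace ℂ (Fin n)) (t : ℝ) : EuclideanSpace ℂ (Fin n) :=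
  WithLp.toLp 2 fun j => Real.exp (-(inner ℝ v (weight Q j)) * t) • z j

lemma isGradientFlowLine_explicitFlow (z : EuclideanSpace ℂ (Fin n)) :
    IsGradientFlowLine (momentComponent Q τ v) z (explicitFlow Q v z) := by
  refine ⟨by ext j; simp [explicitFlow], fun t => ?_⟩
  rw [gradient_momentComponent]
  have h1 : HasDerivAt (fun (t : ℝ) (j : Fin n) => Real.exp (-(inner ℝ v (weight Q j)) * t) • z j)
      (fun j => (-(inner ℝ v (weight Q j) : ℝ)) • (explicitFlow Q v z t) j) t := by
    refine hasDerivAt_pi.2 fun j => ?_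
    have h := (((hasDerivAt_id t).const_mul (-(inner ℝ v (weight Q j) : ℝ))).exp).smul_const (z j)
    refine h.congr_deriv ?_
    simp only [explicitFlow, id, smul_smul, mul_one]
    rw [mul_comm]
  exact (PiLp.hasFDerivAt_toLp (𝕜 := ℝ) 2 _).comp_hasDerivAt t h1

/-- Uniqueness by the integrating factor `exp(w t)` in each coordinate. It is needed because
`gradientFlow` is an arbitrary choice of flow line. -/
lemma IsGradientFlowLine.eq_explicitFlow {z : EuclideanSpace ℂ (Fin n)}
    {γ : ℝ → EuclideanSpace ℂ (Fin n)} (h : IsGradientFlowLine (momentComponent Q τ v) z γ) :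
    γ = explicitFlow Q v z := by
  funext t
  ext j
  set w : ℝ := inner ℝ v (weight Q j) with hw
  have h1 : ∀ t, HasDerivAt (fun t => γ t j) (-w • γ t j) t := by
    intro t
    have h2 := h.2 t
    rw [gradient_momentComponent] at h2
    exact (PiLp.proj (𝕜 := ℝ) 2 (fun _ : Fin n => ℂ) j).hasFDerivAt.comp_hasDerivAt t h2
  have h3 : ∀ t, HasDerivAt (fun t => Real.exp (w * t) • γ t j) 0 t := by
    intro t
    have h4 := (((hasDerivAt_id t).const_mul w).exp).smul (h1 t)
    refine h4.congr_deriv ?_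
    simp only [id, mul_one, smul_smul, ← add_smul]
    convert! zero_smul ℝ _
    ring
  have h5 := is_const_of_deriv_eq_zero (fun t => (h3 t).differentiableAt)
    (fun t => (h3 t).deriv) t 0
  simp only [mul_zero, Real.exp_zero, one_smul, h.1] at h5
  change γ t j = Real.exp (-w * t) • z j
  rw [← h5, smul_smul, ← Real.exp_add]
  simp

lemma gradientFlow_eq (z : EuclideanSpace ℂ (Fin n)) (t : ℝ) :
    gradientFlow (momentComponent Q τ v) t z = explicitFlow Q v z t := by
  have h : ∃ γ, IsGradientFlowLine (momentComponent Q τ v) z γ :=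
    ⟨_, isGradientFlowLine_explicitFlow Q τ v z⟩
  rw [gradientFlow, dif_pos h, h.choose_spec.eq_explicitFlow]

lemma momentComponent_gradientFlow (z : EuclideanSpace ℂ (Fin n)) (t : ℝ) :
    momentComponent Q τ v (gradientFlow (momentComponent Q τ v) t z) =
      (1 / 2) * inner ℝ v τ + ∑ j, -(1 / 2) * inner ℝ v (weight Q j) * ‖z j‖ ^ 2 *
        Real.exp (-(2 * inner ℝ v (weight Q j)) * t) := by
  rw [gradientFlow_eq, momentComponent_eq]
  congr 1
  refine Finset.sum_congr rfl fun j _ => ?_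
  have : Real.exp (-(2 * inner ℝ v (weight Q j)) * t) =
      Real.exp (-(inner ℝ v (weight Q j)) * t) ^ 2 := by
    rw [← Real.exp_nat_mul]
    congr 1
    push_cast
    ring
  rw [this]
  simp only [explicitFlow, norm_smul, Real.norm_eq_abs, Real.abs_exp]
  ring

/-- Along the flow, a coordinate of positive weight decays exponentially, and one of weight zero
does not contribute to `⟨v, μ⟩`. -/
lemma maxWeight_of_nonneg {z : EuclideanSpace ℂ (Fin n)}
    (h : ∀ j, z j ≠ 0 → 0 ≤ (inner ℝ v (weight Q j) : ℝ)) :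
    maxWeight Q τ z v = (((1 / 2) * inner ℝ v τ : ℝ) : EReal) := by
  refine Tendsto.limUnder_eq ?_
  simp only [momentComponent_gradientFlow]
  refine (continuous_coe_real_ereal.tendsto _).comp ?_
  have h1 : Tendsto (fun t : ℝ => ∑ j, -(1 / 2) * inner ℝ v (weight Q j) * ‖z j‖ ^ 2 *
      Real.exp (-(2 * inner ℝ v (weight Q j)) * t)) atTop (𝓝 (∑ _j : Fin n, 0)) := by
    refine tendsto_finsetSum _ fun j _ => ?_
    by_cases hz : z j = 0
    · simp [hz]
    rcases (h j hz).eq_or_lt with hw | hw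
    · simp [← hw]
    · have h2 : Tendsto (fun t : ℝ => Real.exp (-(2 * inner ℝ v (weight Q j)) * t)) atTop (𝓝 0) :=
        Real.tendsto_exp_atBot.comp (tendsto_id.const_mul_atTop_of_neg (by linarith))
      have h3 := h2.const_mul (-(1 / 2) * inner ℝ v (weight Q j) * ‖z j‖ ^ 2)
      rwa [mul_zero] at h3
  simpa using h1.const_add ((1 / 2) * inner ℝ v τ)

/-- The `j`-th term of `⟨v, μ⟩` grows exponentially, while all other terms stay bounded below for `t
≥ 0`. -/
lemma maxWeight_of_neg {z : EuclideanSpace ℂ (Fin n)} {j : Fin n} (hz : z j ≠ 0)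
    (hj : (inner ℝ v (weight Q j) : ℝ) < 0) : maxWeight Q τ z v = ⊤ := by
  refine Tendsto.limUnder_eq ?_
  simp only [momentComponent_gradientFlow]
  rw [EReal.tendsto_coe_nhds_top_iff]
  refine tendsto_atTop_add_const_left _ _ ?_
  set g : Fin n → ℝ → ℝ := fun j t => -(1 / 2) * inner ℝ v (weight Q j) * ‖z j‖ ^ 2 *
    Real.exp (-(2 * inner ℝ v (weight Q j)) * t) with hg
  have hlow : ∀ i, ∀ t ≥ 0, -((1 / 2) * |inner ℝ v (weight Q i)| * ‖z i‖ ^ 2) ≤ g i t := by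
    intro i t ht
    simp only [hg]
    rcases le_total (inner ℝ v (weight Q i) : ℝ) 0 with hw | hw
    · have h1 : 0 ≤ -(1 / 2) * inner ℝ v (weight Q i) * ‖z i‖ ^ 2 *
          Real.exp (-(2 * inner ℝ v (weight Q i)) * t) := by
        refine mul_nonneg (mul_nonneg ?_ (sq_nonneg _)) (Real.exp_pos _).le
        linarith
      refine le_trans ?_ h1
      rw [neg_nonpos]
      positivity
    · rw [abs_of_nonneg hw]
      have h1 : Real.exp (-(2 * inner ℝ v (weight Q i)) * t) ≤ 1 := by
        rw [Real.exp_le_one_iff]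
        nlinarith
      have h2 : 0 ≤ (1 / 2) * inner ℝ v (weight Q i) * ‖z i‖ ^ 2 := by positivity
      nlinarith
  have hgj : Tendsto (g j) atTop atTop := by
    refine Tendsto.const_mul_atTop ?_ ?_
    · have : 0 < ‖z j‖ ^ 2 := by positivity
      exact mul_pos (by linarith) this
    · exact Real.tendsto_exp_atTop.comp (tendsto_id.const_mul_atTop (by linarith))
  refine tendsto_atTop_mono' atTop ?_ (tendsto_atTop_add_const_right _
    (∑ i ∈ Finset.univ.erase j, -((1 / 2) * |inner ℝ v (weight Q i)| * ‖z i‖ ^ 2)) hgj)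
  filter_upwards [eventually_ge_atTop 0] with t ht
  rw [← Finset.add_sum_erase _ _ (Finset.mem_univ j)]
  exact add_le_add le_rfl (Finset.sum_le_sum fun i _ => hlow i t ht)

end MaxWeight

/-! ### Integrals of extended real functions -/

section EIntegral

variable {X : Type*} [MeasurableSpace X] {μ : Measure X}

lemma coe_toReal_of_ne_top {b : ENNReal} (hb : b ≠ ⊤) :
    ((b.toReal : ℝ) : EReal) = (b : EReal) := by
  lift b to NNReal using hb
  rfl

lemma eIntegral_coe {h : X → ℝ} (hh : Integrable h μ) :
    eIntegral μ (fun x => ((h x : ℝ) : EReal)) = ((∫ x, h x ∂μ : ℝ) : EReal) := by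
  rw [integral_eq_lintegral_pos_part_sub_lintegral_neg_part hh, EReal.coe_sub, eIntegral,
    coe_toReal_of_ne_top hh.lintegral_lt_top.ne,
    coe_toReal_of_ne_top (b := ∫⁻ x, ENNReal.ofReal (-h x) ∂μ) hh.neg.lintegral_lt_top.ne]
  rfl

/-- The positive part has infinite integral. The lower bound and the finite measure keep the
negative part finite, so no `⊤ - ⊤`, which is `⊥` in `EReal`, arises. -/
lemma eIntegral_pos_of_top [IsFiniteMeasure μ] {f : X → EReal} {C : ℝ}
    (hC : ∀ x, ((-C : ℝ) : EReal) ≤ f x) {T : Set X} (hT : MeasurableSet T) (hμ : μ T ≠ 0)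
    (hf : ∀ x ∈ T, f x = ⊤) : 0 < eIntegral μ f := by
  have h1 : ∫⁻ x, (f x).toENNReal ∂μ = ⊤ := by
    rw [eq_top_iff]
    calc (⊤ : ENNReal) = ∫⁻ x in T, ⊤ ∂μ := by
          rw [setLIntegral_const, ENNReal.top_mul hμ]
      _ = ∫⁻ x in T, (f x).toENNReal ∂μ := by
          refine setLIntegral_congr_fun hT fun x hx => ?_
          simp [hf x hx]
      _ ≤ _ := setLIntegral_le_lintegral _ _
  have h2 : ∫⁻ x, (-(f x)).toENNReal ∂μ ≠ ⊤ := by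
    refine ne_top_of_le_ne_top ?_ (lintegral_mono (g := fun _ => ENNReal.ofReal C) fun x => ?_)
    · rw [lintegral_const]
      exact ENNReal.mul_ne_top ENNReal.ofReal_ne_top (measure_ne_top _ _)
    · rw [← EReal.real_coe_toENNReal]
      refine EReal.toENNReal_le_toENNReal ?_
      rw [EReal.neg_le]
      exact_mod_cast hC x
  rw [eIntegral, h1, ← coe_toReal_of_ne_top h2, EReal.coe_ennreal_top, EReal.top_sub_coe]
  exact EReal.zero_lt_top

end EIntegral

section ConeAndStabilizer

variable {ι : Type*} {m k n : ℕ} {M : Type*} [TopologicalSpace M] [ChartedSpace (Model m) M]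
  {P : TorusBundle ι m k M} {Q : Fin n → Fin k → ℤ}

/-! ### The interior of the cone -/

namespace BundleSection

variable (s : BundleSection P Q)

lemma weight_mem_cone {j : Fin n} (hj : j ∈ s.support) : weight Q j ∈ s.cone := by
  classical
  refine ⟨Pi.single j 1, fun i => ?_, fun i hi => ?_, ?_⟩
  · by_cases h : i = j
    · subst h; simp
    · simp [Pi.single_eq_of_ne h]
  · exact Pi.single_eq_of_ne (fun h => hi (by rwa [h])) _
  · simp [Pi.single_apply, ite_smul]

lemma zero_mem_cone : (0 : RVec k) ∈ s.cone := ⟨0, by simp, by simp, by simp⟩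

lemma convex_cone : Convex ℝ s.cone := by
  rintro _ ⟨c, hc, hc', rfl⟩ _ ⟨d, hd, hd', rfl⟩ a b ha hb _
  refine ⟨fun j => a * c j + b * d j, fun j => ?_, fun j hj => ?_, ?_⟩
  · exact add_nonneg (mul_nonneg ha (hc j)) (mul_nonneg hb (hd j))
  · simp [hc' j hj, hd' j hj]
  · simp only [add_smul, mul_smul, Finset.sum_add_distrib, Finset.smul_sum]

lemma smul_mem_cone {r : ℝ} (hr : 0 ≤ r) {x : RVec k} (hx : x ∈ s.cone) : r • x ∈ s.cone := by
  obtain ⟨c, hc, hc', rfl⟩ := hx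
  exact ⟨fun j => r * c j, fun j => mul_nonneg hr (hc j), fun j hj => by simp [hc' j hj],
    by simp only [mul_smul, Finset.smul_sum]⟩

/-- A finite-dimensional convex set has interior as soon as its affine span is everything; the cone
contains `0` and the spanning weights. -/
lemma interior_cone_nonempty (hs : s.weightSpan = ⊤) : (interior s.cone).Nonempty := by
  rw [s.convex_cone.interior_nonempty_iff_affineSpan_eq_top,
    AffineSubspace.affineSpan_eq_top_iff_vectorSpan_eq_top_of_nonempty _ _ _ ⟨0, s.zero_mem_cone⟩,
    vectorSpan_eq_span_vsub_set_right ℝ s.zero_mem_cone, eq_top_iff, ← hs]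
  refine Submodule.span_mono ?_
  rintro _ ⟨j, hj, rfl⟩
  exact ⟨_, s.weight_mem_cone hj, by simp⟩

lemma mem_coneInterior_iff_mem_interior (hs : s.weightSpan = ⊤) (σ : RVec k) :
    σ ∈ s.coneInterior ↔ σ ∈ interior s.cone := by
  have hopen : IsOpen (s.weightSpan : Set (RVec k)) := by
    rw [hs]
    exact isOpen_univ
  have h1 := hopen.isOpenMap_subtype_val.preimage_interior_eq_interior_preimage
    continuous_subtype_val s.cone
  rw [coneInterior]
  change σ ∈ Subtype.val '' interior
    (Subtype.val ⁻¹' s.cone : Set (s.weightSpan : Set (RVec k))) ↔ _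
  rw [← h1, Subtype.image_preimage_coe, hs]
  simp

/-- The interior of the cone is characterized by the dual cone. -/
lemma mem_interior_cone_iff (hs : s.weightSpan = ⊤) (σ : RVec k) :
    σ ∈ interior s.cone ↔ ∀ v : RVec k, v ≠ 0 →
      (∀ j ∈ s.support, 0 ≤ (inner ℝ v (weight Q j) : ℝ)) → 0 < (inner ℝ v σ : ℝ) := by
  constructor
  · intro hσ v hv hw
    have hnn : ∀ x ∈ s.cone, 0 ≤ (inner ℝ v x : ℝ) := by
      rintro _ ⟨c, hc, hc', rfl⟩
      rw [inner_sum]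
      refine Finset.sum_nonneg fun j _ => ?_
      rw [inner_smul_right]
      by_cases hj : j ∈ s.support
      · exact mul_nonneg (hc j) (hw j hj)
      · simp [hc' j hj]
    -- An interior point can be moved slightly against `v` within the cone, and pairing with `v`
    -- gives `⟨v, σ⟩ ≥ r ‖v‖² > 0`.
    have hcont : Tendsto (fun r : ℝ => σ - r • v) (𝓝 0) (𝓝 σ) := by
      have : Continuous fun r : ℝ => σ - r • v := by fun_prop
      simpa using this.tendsto 0
    have hev : ∀ᶠ r in 𝓝[>] (0 : ℝ), σ - r • v ∈ s.cone :=
      (hcont.eventually (mem_interior_iff_mem_nhds.1 hσ)).filter_mono nhdsWithin_le_nhds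
    obtain ⟨r, hr, hr0⟩ := (hev.and self_mem_nhdsWithin).exists
    have h1 := hnn _ hr
    rw [inner_sub_right, inner_smul_right, real_inner_self_eq_norm_sq] at h1
    have h2 : 0 < r * ‖v‖ ^ 2 := mul_pos hr0 (by positivity)
    linarith
  · intro h
    by_contra hσ
    -- If `σ` is not interior, minus the separating functional is a nonzero element of the dual cone
    -- whose pairing with `σ` is not positive.
    obtain ⟨f, hf⟩ := geometric_hahn_banach_open_point s.convex_cone.interior isOpen_interior hσ
    obtain ⟨x₀, hx₀⟩ := s.interior_cone_nonempty hs
    have hle : ∀ x ∈ s.cone, f x ≤ f σ := by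
      intro x hx
      have hcl : x ∈ closure (interior s.cone) := by
        rw [s.convex_cone.closure_interior_eq_closure_of_nonempty_interior ⟨x₀, hx₀⟩]
        exact subset_closure hx
      have : closure (interior s.cone) ⊆ {y | f y ≤ f σ} :=
        closure_minimal (fun y hy => (hf y hy).le) (isClosed_le f.continuous continuous_const)
      exact this hcl
    have hnonpos : ∀ x ∈ s.cone, f x ≤ 0 := by
      intro x hx
      by_contra! hpos
      -- The factor is chosen so that `f` takes the value `|f σ| + f x > f σ` at the rescaled point
      -- of the cone.
      have h1 := hle ((|f σ| / f x + 1) • x) (s.smul_mem_cone (by positivity) hx)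
      rw [map_smul, smul_eq_mul, add_mul, div_mul_cancel₀ _ hpos.ne'] at h1
      linarith [le_abs_self (f σ)]
    set v := -(InnerProductSpace.toDual ℝ (RVec k)).symm f with hv
    have hinner : ∀ x, (inner ℝ v x : ℝ) = -f x := fun x => by
      rw [hv, inner_neg_left, InnerProductSpace.toDual_symm_apply]
    have hv0 : v ≠ 0 := by
      intro h0
      have h1 := hinner x₀
      have h2 := hinner σ
      rw [h0, inner_zero_left] at h1 h2
      linarith [hf x₀ hx₀]
    have h1 := h v hv0 fun j hj => by
      rw [hinner]
      linarith [hnonpos _ (s.weight_mem_cone hj)]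
    rw [hinner] at h1
    have h2 := hle 0 s.zero_mem_cone
    rw [map_zero] at h2
    linarith

end BundleSection

/-! ### Characters and stabilizers -/

lemma character_mul (q : Fin k → ℤ) (t t' : Fin k → Circle) :
    character q (t * t') = character q t * character q t' := by
  simp [character, mul_zpow, Finset.prod_mul_distrib]

lemma character_ne_zero (q : Fin k → ℤ) (t : Fin k → Circle) : character q t ≠ 0 :=
  Finset.prod_ne_zero_iff.2 fun _ _ => zpow_ne_zero _ (Circle.coe_ne_zero _)

lemma character_inv (q : Fin k → ℤ) (t : Fin k → Circle) :
    character q t⁻¹ = (character q t)⁻¹ := by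
  simp [character]

lemma character_exp (j : Fin n) (θ : RVec k) :
    character (Q j) (fun a => Circle.exp (θ a)) =
      Complex.exp ((inner ℝ θ (weight Q j) : ℝ) * Complex.I) := by
  simp only [character, Circle.coe_exp, ← Complex.exp_int_mul, ← Complex.exp_sum]
  congr 1
  simp only [weight, PiLp.inner_apply]
  push_cast
  rw [Finset.sum_mul]
  refine Finset.sum_congr rfl fun a _ => ?_
  simp [mul_assoc]

variable (A : Connection P) (s : BundleSection P Q)

lemma const_mem_stabilizer {t : Fin k → Circle}
    (ht : ∀ j ∈ s.support, character (Q j) t = 1) : ContinuousMap.const M t ∈ stabilizer A s := by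
  refine ⟨fun a => ?_, fun i a c _ y _ _ v => ?_, fun i j x hx => ?_⟩
  · exact (contMDiff_const (c := (t a : ℂ)) :
      ContMDiff 𝓘(ℝ, Model m) 𝓘(ℝ, ℂ) ∞ fun _ : M => (t a : ℂ))
  · simp
  · by_cases h : s.φ i j x = 0
    · simp [h]
    · simp [ht j ⟨i, x, hx, h⟩]

variable {A s}

lemma character_eq_one_of_mem_stabilizer {u : C(M, Fin k → Circle)} (hu : u ∈ stabilizer A s)
    {j : Fin n} {i : ι} {x : M} (hx : x ∈ P.U i) (h : s.φ i j x ≠ 0) :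
    character (Q j) (u x) = 1 :=
  mul_right_cancel₀ h (by rw [hu.2.2 i j x hx, one_mul])

/-- Fixing the connection means `u⁻¹ du = 0`, so `u` is constant on coordinate balls, hence locally
constant, hence constant. -/
lemma apply_eq_of_mem_stabilizer [IsManifold 𝓘(ℂ, Model m) ω M] [PreconnectedSpace M]
    {u : C(M, Fin k → Circle)} (hu : u ∈ stabilizer A s) (x y : M) : u x = u y := by
  funext a
  have hloc : IsLocallyConstant fun x => (u x a : ℂ) := by
    rw [IsLocallyConstant.iff_eventually_eq]
    intro x
    set c := chartAt (Model m) x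
    have hc : c ∈ atlas (Model m) M := chart_mem_atlas _ _
    have hxc : x ∈ c.source := mem_chart_source _ _
    set W := c.target ∩ c.symm ⁻¹' P.U (P.indexAt x)
    have hW : IsOpen W := isOpen_target_inter c (P.isOpen_U _)
    have hxW : c x ∈ W := ⟨c.map_source hxc, by
      simpa [c.left_inv hxc] using P.mem_indexAt x⟩
    obtain ⟨ε, hε, hball⟩ := Metric.isOpen_iff.1 hW _ hxW
    have hd : ContDiffOn ℝ ∞ (fun y => (u (c.symm y) a : ℂ)) c.target := by
      simpa using contDiffOn_comp_symm (U := Set.univ) (hu.1 a).contMDiffOn hc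
    have hconst : ∀ z ∈ Metric.ball (c x) ε,
        (u (c.symm z) a : ℂ) = (u (c.symm (c x)) a : ℂ) := by
      intro z hz
      refine Metric.isOpen_ball.is_const_of_fderiv_eq_zero (𝕜 := ℝ)
        (f := fun y => (u (c.symm y) a : ℂ)) (convex_ball _ _).isPreconnected
        ((hd.mono fun w hw => (hball hw).1).differentiableOn (by simp)) ?_ hz
        (Metric.mem_ball_self hε)
      intro w hw
      ext v
      have h1 := hu.2.1 _ a c hc w (hball hw).1 (hball hw).2 v
      rw [sub_eq_self, mul_eq_zero] at h1
      exact h1.resolve_left (inv_ne_zero (Circle.coe_ne_zero _))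
    filter_upwards [(c.continuousAt hxc).preimage_mem_nhds (Metric.ball_mem_nhds _ hε),
      c.open_source.mem_nhds hxc] with z hz hzc
    have := hconst (c z) hz
    rwa [c.left_inv hzc, c.left_inv hxc] at this
  exact Circle.ext (hloc.apply_eq_of_preconnectedSpace x y)

variable (A s)

/-- A nonzero `v` orthogonal to the weights generates a one-parameter group of constant gauge
transformations in the stabilizer. In a discrete space this continuous path would be constant. -/
lemma weightSpan_eq_top_of_isSimple [Nonempty M] (h : IsSimple A s) : s.weightSpan = ⊤ := by
  have : DiscreteTopology (stabilizer A s) := h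
  by_contra hne
  have hbot : s.weightSpanᗮ ≠ ⊥ := fun h0 => hne ((Submodule.orthogonal_eq_bot_iff).1 h0)
  obtain ⟨v, hv, hv0⟩ := (Submodule.ne_bot_iff _).1 hbot
  have hmem : ∀ r : ℝ, ContinuousMap.const M (fun a => Circle.exp ((r • v) a)) ∈
      stabilizer A s := fun r => by
    refine const_mem_stabilizer A s fun j hj => ?_
    rw [character_exp, inner_smul_left, real_inner_comm,
      (Submodule.mem_orthogonal _ _).1 hv _ (Submodule.subset_span ⟨j, hj, rfl⟩)]
    simp
  let F : ℝ → stabilizer A s := fun r => ⟨_, hmem r⟩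
  have hF : Continuous F := by
    refine Continuous.subtype_mk (ContinuousMap.continuous_const'.comp ?_) _
    refine continuous_pi fun a => Circle.exp.continuous.comp ?_
    simp only [PiLp.smul_apply, smul_eq_mul]
    fun_prop
  obtain ⟨a, ha⟩ : ∃ a, v a ≠ 0 := by
    by_contra! hall
    exact hv0 (by ext a; simp [hall a])
  -- At this time the `a`-th component of the path is `exp(iπ) = -1`, whereas at time `0` it is `1`.
  have h1 : F (Real.pi / v a) = F 0 := PreconnectedSpace.constant inferInstance hF
  have h2 := congrArg (fun u : stabilizer A s => (u.1 (Classical.arbitrary M) a : ℂ)) h1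
  simp only [F, ContinuousMap.const_apply, PiLp.smul_apply, smul_eq_mul, zero_mul, Circle.exp_zero,
    div_mul_cancel₀ _ ha, Circle.coe_exp, Complex.exp_pi_mul_I, Circle.coe_one] at h2
  norm_num at h2

/-- For `u` near `u₀` the constant quotient `u u₀⁻¹` is `exp(iθ)` with `θ` small. Each `⟨θ, Q_j⟩`,
`j ∈ I_φ`, is a small multiple of `2π`, hence zero, and `θ = 0` because the weights span. -/
lemma isSimple_of_weightSpan_eq_top [IsManifold 𝓘(ℂ, Model m) ω M] [ConnectedSpace M]
    (h : s.weightSpan = ⊤) : IsSimple A s := by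
  rw [IsSimple, discreteTopology_iff_singleton_mem_nhds]
  intro u₀
  set x₀ : M := Classical.arbitrary M
  -- If all `|θ a| < δ`, then `|⟨θ, Q_j⟩| < 1 < 2π` for every `j` at once.
  set δ : ℝ := 1 / (1 + ∑ j, ∑ a, |(Q j a : ℝ)|) with hδ
  have hS : 0 ≤ ∑ j, ∑ a, |(Q j a : ℝ)| := by positivity
  have hδ0 : 0 < δ := by positivity
  have hev : ∀ᶠ u in 𝓝 u₀, ∀ a, |Complex.arg (u.1 x₀ a * (u₀.1 x₀ a)⁻¹ : Circle)| < δ := by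
    rw [eventually_all]
    intro a
    have hc : Continuous fun u : stabilizer A s => ((u.1 x₀ a * (u₀.1 x₀ a)⁻¹ : Circle) : ℂ) := by
      refine continuous_subtype_val.comp (Continuous.mul ?_ continuous_const)
      exact (continuous_apply a).comp
        ((continuous_eval_const x₀).comp continuous_subtype_val)
    have h1 : ContinuousAt (fun z : ℂ => |Complex.arg z|) 1 :=
      (Complex.continuousAt_arg (by simp)).abs
    have h2 : Tendsto (fun u : stabilizer A s =>
        |Complex.arg (u.1 x₀ a * (u₀.1 x₀ a)⁻¹ : Circle)|) (𝓝 u₀) (𝓝 |Complex.arg 1|) := by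
      refine h1.tendsto.comp ?_
      have h3 := hc.tendsto u₀
      simpa using h3
    exact h2.eventually_lt_const (by simpa using hδ0)
  filter_upwards [hev] with u hu
  set d : Fin k → Circle := u.1 x₀ * (u₀.1 x₀)⁻¹ with hd
  set θ : RVec k := WithLp.toLp 2 fun a => Complex.arg (d a) with hθ
  have hdθ : d = fun a => Circle.exp (θ a) := by
    funext a
    simp [hθ]
  have horth : ∀ j ∈ s.support, (inner ℝ θ (weight Q j) : ℝ) = 0 := by
    rintro j ⟨i, x, hx, hjx⟩
    have h1 : character (Q j) d = 1 := by
      rw [hd, character_mul, character_inv, apply_eq_of_mem_stabilizer u.2 x₀ x,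
        apply_eq_of_mem_stabilizer u₀.2 x₀ x, character_eq_one_of_mem_stabilizer u.2 hx hjx,
        character_eq_one_of_mem_stabilizer u₀.2 hx hjx]
      simp
    rw [hdθ, character_exp, Complex.exp_eq_one_iff] at h1
    obtain ⟨N, hN⟩ := h1
    have h2 : (inner ℝ θ (weight Q j) : ℝ) = N * (2 * Real.pi) := by
      have h3 := congrArg Complex.im hN
      simpa using h3
    have hbound : |(inner ℝ θ (weight Q j) : ℝ)| < 1 := by
      calc |(inner ℝ θ (weight Q j) : ℝ)| = |∑ a, θ a * (Q j a : ℝ)| := by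
            simp [weight, PiLp.inner_apply, mul_comm]
        _ ≤ ∑ a, |θ a * (Q j a : ℝ)| := Finset.abs_sum_le_sum_abs _ _
        _ ≤ ∑ a, δ * |(Q j a : ℝ)| := Finset.sum_le_sum fun a _ => by
            rw [abs_mul]
            exact mul_le_mul_of_nonneg_right (hu a).le (abs_nonneg _)
        _ = δ * ∑ a, |(Q j a : ℝ)| := by rw [Finset.mul_sum]
        _ ≤ δ * ∑ j, ∑ a, |(Q j a : ℝ)| := by
            refine mul_le_mul_of_nonneg_left ?_ hδ0.le
            exact Finset.single_le_sum (f := fun j => ∑ a, |(Q j a : ℝ)|)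
              (fun i _ => by positivity) (Finset.mem_univ j)
        _ < 1 := by
            rw [hδ, one_div, inv_mul_lt_one₀ (by positivity)]
            linarith
    have hN0 : N = 0 := by
      by_contra hne
      have h3 : (1 : ℝ) ≤ |(N : ℝ)| := by exact_mod_cast Int.one_le_abs hne
      rw [h2, abs_mul, abs_of_pos Real.two_pi_pos] at hbound
      nlinarith [Real.pi_gt_three]
    rw [h2, hN0]
    simp
  have hθ0 : θ = 0 := by
    have : θ ∈ s.weightSpanᗮ := by
      rw [BundleSection.weightSpan, Submodule.mem_orthogonal]
      intro w hw
      induction hw using Submodule.span_induction with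
      | mem w hw =>
        obtain ⟨j, hj, rfl⟩ := hw
        rw [real_inner_comm]
        exact horth j hj
      | zero => exact inner_zero_left _
      | add x y _ _ hx hy => rw [inner_add_left, hx, hy, add_zero]
      | smul r x _ hx => rw [inner_smul_left, hx, mul_zero]
    rw [h, Submodule.top_orthogonal_eq_bot] at this
    exact this
  have hd1 : d = 1 := by
    rw [hdθ, hθ0]
    funext a
    simp
  rw [Set.mem_singleton_iff]
  refine Subtype.ext (ContinuousMap.ext fun x => ?_)
  rw [apply_eq_of_mem_stabilizer u.2 x x₀, apply_eq_of_mem_stabilizer u₀.2 x x₀]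
  exact mul_inv_eq_one.1 hd1

end ConeAndStabilizer

/-! ### Stability -/

section Stability

variable {ι : Type*} {m k n : ℕ} {M : Type*} [TopologicalSpace M] [ChartedSpace (Model m) M]
  {P : TorusBundle ι m k M} {Q : Fin n → Fin k → ℤ}

namespace BundleSection

variable (s : BundleSection P Q)

lemma mem_support_of_value_ne_zero {x : M} {j : Fin n} (h : s.value x j ≠ 0) : j ∈ s.support :=
  ⟨P.indexAt x, x, P.mem_indexAt x, h⟩

lemma value_ne_zero_iff {i : ι} {x : M} (hx : x ∈ P.U i) (j : Fin n) :
    s.value x j ≠ 0 ↔ s.φ i j x ≠ 0 := by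
  change s.φ (P.indexAt x) j x ≠ 0 ↔ _
  rw [s.transition _ i j x ⟨P.mem_indexAt x, hx⟩]
  simp [character_ne_zero]

/-- `value` need not be continuous, since its trivialization varies with the point, but characters
never vanish, so its zeros can be detected in one fixed trivialization. -/
lemma isOpen_value_ne_zero (j : Fin n) : IsOpen {x | s.value x j ≠ 0} := by
  rw [isOpen_iff_mem_nhds]
  intro x hx
  have hU := (P.isOpen_U (P.indexAt x)).mem_nhds (P.mem_indexAt x)
  have hc := ((s.smooth (P.indexAt x) j).continuousOn).continuousAt hU
  filter_upwards [hU, hc.eventually_ne hx] with z hz hz'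
  exact (s.value_ne_zero_iff hz j).2 hz'

end BundleSection

variable [IsManifold 𝓘(ℂ, Model m) ω M] [MeasurableSpace M] [BorelSpace M] [CompactSpace M]
  (Ω : KahlerForm m M) {e : ℝ} (τ : RVec k) (A : Connection P) (s : BundleSection P Q)

/-- Here `λ` is the constant `⟨v, τ⟩ / 2`, so the integrand is the continuous real function `⟨v, e²
τ - iΛF⟩`. -/
lemma eIntegral_stability_of_nonneg [Nonempty M] (he : 0 < e) {v : RVec k}
    (hv : ∀ j ∈ s.support, 0 ≤ (inner ℝ v (weight Q j) : ℝ)) :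
    eIntegral Ω.vol (fun x => ((inner ℝ v (-iLambdaF Ω A x) : ℝ) : EReal) +
      ((2 * e ^ 2 : ℝ) : EReal) * maxWeight Q τ (s.value x) v) =
      ((e ^ 2 * inner ℝ v (stabilityVector Ω e τ A) : ℝ) : EReal) := by
  have h1 : ∀ x, ((inner ℝ v (-iLambdaF Ω A x) : ℝ) : EReal) +
      ((2 * e ^ 2 : ℝ) : EReal) * maxWeight Q τ (s.value x) v =
      ((∑ a, v a * (e ^ 2 * τ a - iLambdaF Ω A x a) : ℝ) : EReal) := by
    intro x
    rw [maxWeight_of_nonneg Q τ v fun j hj => hv j (s.mem_support_of_value_ne_zero hj),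
      ← EReal.coe_mul, ← EReal.coe_add]
    congr 1
    simp only [PiLp.inner_apply, PiLp.neg_apply, RCLike.inner_apply, conj_trivial]
    rw [Finset.mul_sum, Finset.mul_sum, ← Finset.sum_add_distrib]
    refine Finset.sum_congr rfl fun a _ => ?_
    ring
  have hint : ∀ a, Integrable (fun x => v a * (e ^ 2 * τ a - iLambdaF Ω A x a)) Ω.vol := fun a =>
    Ω.integrable_of_continuous
      (continuous_const.mul (continuous_const.sub (A.continuous_iLambdaF_apply Ω a)))
  simp only [h1]
  rw [eIntegral_coe (integrable_finsetSum _ fun a _ => hint a),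
    integral_finsetSum _ fun a _ => hint a]
  congr 1
  simp only [PiLp.inner_apply, RCLike.inner_apply, conj_trivial]
  rw [Finset.mul_sum]
  refine Finset.sum_congr rfl fun a _ => ?_
  rw [← mul_assoc, stabilityVector_apply Ω he, integral_const_mul,
    integral_sub (integrable_const _)
      (Ω.integrable_of_continuous (A.continuous_iLambdaF_apply Ω a)), integral_const,
    KahlerForm.totalVol, smul_eq_mul]
  ring

/-- The integrand is `+∞` where `φ^j ≠ 0`, an open set of positive volume. It is bounded below
everywhere, since the curvature term is continuous on a compact space. -/
lemma eIntegral_stability_pos_of_neg (he : 0 < e) {v : RVec k} {j : Fin n} (hj : j ∈ s.support)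
    (hv : (inner ℝ v (weight Q j) : ℝ) < 0) :
    0 < eIntegral Ω.vol (fun x => ((inner ℝ v (-iLambdaF Ω A x) : ℝ) : EReal) +
      ((2 * e ^ 2 : ℝ) : EReal) * maxWeight Q τ (s.value x) v) := by
  have hcont : Continuous fun x => (inner ℝ v (-iLambdaF Ω A x) : ℝ) :=
    continuous_const.inner (A.continuous_iLambdaF Ω).neg
  obtain ⟨C, hC⟩ := (isCompact_univ.image hcont).isBounded.exists_norm_le
  have hC' : ∀ x, |(inner ℝ v (-iLambdaF Ω A x) : ℝ)| ≤ C := fun x =>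
    hC _ ⟨x, trivial, rfl⟩
  have he2 : 0 < 2 * e ^ 2 := by positivity
  have htop : ((2 * e ^ 2 : ℝ) : EReal) * ⊤ = ⊤ := EReal.coe_mul_top_of_pos he2
  refine eIntegral_pos_of_top (C := C + |e ^ 2 * inner ℝ v τ|) (T := {x | s.value x j ≠ 0})
    (fun x => ?_) (s.isOpen_value_ne_zero j).measurableSet ?_ fun x hx => ?_
  · by_cases h : ∀ i, s.value x i ≠ 0 → 0 ≤ (inner ℝ v (weight Q i) : ℝ)
    · rw [maxWeight_of_nonneg Q τ v h, ← EReal.coe_mul, ← EReal.coe_add, EReal.coe_le_coe_iff]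
      have h1 := (abs_le.1 (hC' x)).1
      have h2 := neg_abs_le (e ^ 2 * (inner ℝ v τ : ℝ))
      linarith
    · push Not at h
      obtain ⟨i, hi, hi'⟩ := h
      rw [maxWeight_of_neg Q τ v hi hi', htop, EReal.coe_add_top]
      exact le_top
  · obtain ⟨i, x, hx, hjx⟩ := hj
    exact (s.isOpen_value_ne_zero j).measure_ne_zero _ ⟨x, (s.value_ne_zero_iff hx j).2 hjx⟩
  · rw [maxWeight_of_neg Q τ v hx hv, htop, EReal.coe_add_top]

lemma isTauStable_iff [Nonempty M] (he : 0 < e) : IsTauStable Ω e τ A s ↔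
    ∀ v : RVec k, v ≠ 0 → (∀ j ∈ s.support, 0 ≤ (inner ℝ v (weight Q j) : ℝ)) →
      0 < (inner ℝ v (stabilityVector Ω e τ A) : ℝ) := by
  refine forall₂_congr fun v _ => ?_
  by_cases hw : ∀ j ∈ s.support, 0 ≤ (inner ℝ v (weight Q j) : ℝ)
  · rw [eIntegral_stability_of_nonneg Ω τ A s he hw, EReal.coe_pos]
    simp only [forall_prop_of_true hw]
    exact mul_pos_iff_of_pos_left (by positivity)
  · have hw' := hw
    push Not at hw'
    obtain ⟨j, hj, hneg⟩ := hw'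
    exact iff_of_true (eIntegral_stability_pos_of_neg Ω τ A s he hj hneg) fun h => absurd h hw

lemma stabilityVector_eq [Nonempty M] [T2Space M] (he : 0 < e) (B : Connection P) :
    stabilityVector Ω e τ A = stabilityVector Ω e τ B := by
  ext a
  have h : e ^ 2 * stabilityVector Ω e τ A a = e ^ 2 * stabilityVector Ω e τ B a := by
    rw [stabilityVector_apply Ω he, stabilityVector_apply Ω he, A.integral_iLambdaF_eq B]
  exact mul_left_cancel₀ (by positivity) h

end Stability

end GLSM

end

/-! ### The criteria for simplicity and stability -/

theorem mainTheorem2 {ι : Type*} {m k n : ℕ} {M : Type*}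
    [TopologicalSpace M] [T2Space M] [CompactSpace M] [ConnectedSpace M]
    [ChartedSpace (GLSM.Model m) M] [IsManifold 𝓘(ℂ, GLSM.Model m) ω M]
    [MeasurableSpace M] [BorelSpace M]
    (Ω : GLSM.KahlerForm m M) (P : GLSM.TorusBundle ι m k M) (Q : Fin n → Fin k → ℤ)
    (e : ℝ) (he : 0 < e) (τ : GLSM.RVec k)
    (A : GLSM.Connection P) (s : GLSM.BundleSection P Q)
    (h_first : GLSM.FirstVortexEq A s) (h_third : GLSM.ThirdVortexEq A) :
    (GLSM.IsSimple A s ↔ s.weightSpan = ⊤) ∧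
    (GLSM.IsSimple A s →
      ∀ B : GLSM.Connection P,
        (GLSM.IsTauStable Ω e τ A s ↔ GLSM.stabilityVector Ω e τ B ∈ s.coneInterior)) := by
  refine ⟨⟨fun h => GLSM.weightSpan_eq_top_of_isSimple A s h,
    fun h => GLSM.isSimple_of_weightSpan_eq_top A s h⟩, fun h B => ?_⟩
  have hspan := GLSM.weightSpan_eq_top_of_isSimple A s h
  rw [GLSM.isTauStable_iff Ω τ A s he, s.mem_coneInterior_iff_mem_interior hspan,
    s.mem_interior_cone_iff hspan, GLSM.stabilityVector_eq Ω τ A he B]
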